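/- Let $d$ be a positive integer, let $\langle\cdot,\cdot\rangle$ and $\|\cdot\|$ be the standard scalar product and norm of $\mathbb R^d$ (with $\langle t,v\rangle=\sum_j t_jv_j$ also for $t\in\mathbb R^d$, $v\in\mathbb C^d$), and for $Y\subset\mathbb R^d$ let $$\langle Y\rangle=\Bigl\{\sum_{k=1}^n z_k y_k^{(1)}\colon n\in\mathbb N,\ z_k\in\mathbb Z,\ y_k\in Y\Bigr\}\times\dots\times\Bigl\{\sum_{k=1}^n z_k y_k^{(d)}\colon n\in\mathbb N,\ z_k\in\mathbb Z,\ y_k\in Y\Bigr\},$$ where $y_k=(y_k^{(1)},\dots,y_k^{(d)})$. Let $h\colon\mathbb R^d\to\mathbb C$ be of the form $$h(t)=\sum_{y\in Y}q_y e^{i\langle t,y\rangle},\qquad t\in\mathbb R^d,$$ where $Y\subset\mathbb R^d$ is a nonempty at most countable set, $q_y\in\mathbb C$ for $y\in Y$, $0<\sum_{y\in Y}|q_y|<\infty$, and $h(0)=\sum_{y\in Y}q_y=1$. Then the following statements are equivalent: (i) $\inf_{t\in\mathbb R^d}|h(t)|>0$; (ii) $h$ has no zeros, and there exist an at most countable set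 $Z\subset\mathbb R^d$ and coefficients $r_z\in\mathbb C$, $z\in Z$, with $\sum_{z\in Z}|r_z|<\infty$, such that $$\frac1{h(t)}=\sum_{z\in Z}r_z e^{i\langle t,z\rangle},\qquad t\in\mathbb R^d;$$ (iii) there exist $\gamma\in\langle Y\rangle$ and $\lambda_u\in\mathbb C$, $u\in\langle Y\rangle\setminus\{0\}$, with $\sum_{u\in\langle Y\rangle\setminus\{0\}}|\lambda_u|<\infty$, such that $$h(t)=\exp\Bigl\{i\langle t,\gamma\rangle+\sum_{u\in\langle Y\rangle\setminus\{0\}}\lambda_u\bigl(e^{i\langle t,u\rangle}-1\bigr)\Bigr\},\qquad t\in\mathbb R^d;$$ (iv) there exist $\gamma\in\mathbb C^d$, a matrix $Q\in\mathbb C^{d\times d}$ and a complex measure $\nu$ on $\mathbb R^d$ with $\nu(\{0\})=0$ and $\int_{\mathbb R^d}\min\{\|x\|^2,1\}\,|\nu|(dx)<\infty$, where $|\nu|$ is the total variation of $\nu$, such that $$h(t)=\exp\Bigl\{i\langle t,\gamma\rangle-\tfrac12\langle t,Qt\rangle+\int_{\mathbb R^d}\Bigl(e^{i\langle t,u\rangle}-1-\frac{i\langle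 t,u\rangle}{1+\|u\|^2}\Bigr)\nu(du)\Bigr\},\qquad t\in\mathbb R^d.$$ Here, as usual for Lévy–Khintchine representations, the complex measure $\nu$ is only required to be finite on each set $\{x\colon\|x\|\ge r\}$, $r>0$: it is given by a compatible family of finite complex measures on these sets, and its total variation near $0$ may be infinite. -/

import Mathlib

open MeasureTheory Filter Topology
open scoped ENNReal Matrix

/-- The module `⟨Y⟩` over the ring `ℤ^d` generated by `Y ⊆ ℝ^d`: the product over the coordinates
`j` of the sets of all finite integer linear combinations of the `j`-th coordinates of the points
of `Y`. -/
def coordSpan {d : ℕ} (Y : Set (EuclideanSpace ℝ (Fin d))) : Set (EuclideanSpace ℝ (Fin d)) :=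
  {u | ∀ j, u j ∈ AddSubgroup.closure ((fun y : EuclideanSpace ℝ (Fin d) => y j) '' Y)}

/-- The character `t ↦ e^{i⟨t,u⟩}` of `ℝ^d`. -/
noncomputable def expChar {d : ℕ} (t u : EuclideanSpace ℝ (Fin d)) : ℂ :=
  Complex.exp (Complex.I * ((inner ℝ t u : ℝ) : ℂ))

/-- A complex measure `ν` on `ℝ^d` with `ν({0}) = 0` that is only required to be finite away from
the origin, as in Lévy–Khintchine representations: for every `r > 0` a finite complex measure
`trunc r`, the restriction of `ν` to `{x | r ≤ ‖x‖}`, such that these restrictions are compatible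
with each other. (With `r = s`, the compatibility says that `trunc r` lives on `{x | r ≤ ‖x‖}`.
The values `trunc r` for `r ≤ 0` are irrelevant. The total variation of `ν` on all of
`ℝ^d ∖ {0}` may be infinite, and then `ν` is not a `MeasureTheory.ComplexMeasure`.) -/
structure ComplexLevyMeasure (d : ℕ) where
  /-- The restriction of `ν` to `{x | r ≤ ‖x‖}`, for `r > 0`. -/
  trunc : ℝ → ComplexMeasure (EuclideanSpace ℝ (Fin d))
  trunc_apply : ∀ r s : ℝ, 0 < r → r ≤ s → ∀ B : Set (EuclideanSpace ℝ (Fin d)),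
    MeasurableSet B → trunc s B = trunc r (B ∩ {x | s ≤ ‖x‖})

namespace ComplexLevyMeasure

variable {d : ℕ}

/-- The total variation `|ν|`, a positive measure on `ℝ^d`: the supremum, that is the increasing
limit as `r ↓ 0`, of the total variations of the restrictions of `ν` to `{x | r ≤ ‖x‖}`. -/
noncomputable def totalVariation (ν : ComplexLevyMeasure d) :
    Measure (EuclideanSpace ℝ (Fin d)) :=
  ⨆ r : Set.Ioi (0 : ℝ), (ν.trunc r).variation

lemma measurableSet_away (s : ℝ) :
    MeasurableSet {x : EuclideanSpace ℝ (Fin d) | s ≤ ‖x‖} :=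
  measurableSet_le measurable_const measurable_norm

lemma variation_trunc (ν : ComplexLevyMeasure d) {r s : ℝ} (hr : 0 < r) (hrs : r ≤ s) :
    (ν.trunc s).variation = (ν.trunc r).variation.restrict {x | s ≤ ‖x‖} := by
  have h : ν.trunc s = (ν.trunc r).restrict {x | s ≤ ‖x‖} := by
    ext B hB
    rw [VectorMeasure.restrict_apply _ (measurableSet_away s) hB, ν.trunc_apply r s hr hrs B hB]
  rw [h, VectorMeasure.variation_restrict (measurableSet_away s)]

/-- The total variation is the increasing limit set by set. -/
lemma totalVariation_apply (ν : ComplexLevyMeasure d) {B : Set (EuclideanSpace ℝ (Fin d))}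
    (hB : MeasurableSet B) :
    ν.totalVariation B = ⨆ r : Set.Ioi (0 : ℝ), (ν.trunc r).variation B := by
  have hdir : Directed (· ≤ ·) (fun r : Set.Ioi (0 : ℝ) => (ν.trunc r).variation) := by
    intro r s
    have hk : (0 : ℝ) < min (r : ℝ) s := lt_min r.2 s.2
    refine ⟨⟨min (r : ℝ) s, hk⟩, ?_, ?_⟩
    · dsimp only
      rw [ν.variation_trunc hk (min_le_left (r : ℝ) s)]
      exact Measure.restrict_le_self
    · dsimp only
      rw [ν.variation_trunc hk (min_le_right (r : ℝ) s)]
      exact Measure.restrict_le_self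
  apply le_antisymm
  · let m : Measure (EuclideanSpace ℝ (Fin d)) :=
      Measure.ofMeasurable (fun A _ => ⨆ r : Set.Ioi (0 : ℝ), (ν.trunc r).variation A)
        (by simp) (by
          intro f hf hd
          have : ∀ r : Set.Ioi (0 : ℝ), (ν.trunc r).variation (⋃ i, f i) =
              ∑' i, (ν.trunc r).variation (f i) := fun r => measure_iUnion hd hf
          simp only [this, ENNReal.tsum_eq_iSup_sum]
          rw [iSup_comm]
          refine iSup_congr fun a => ?_
          refine (ENNReal.finsetSum_iSup fun r s => ?_).symm
          obtain ⟨k, h1, h2⟩ := hdir r s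
          exact ⟨k, fun i => ⟨h1 _, h2 _⟩⟩)
    have hm : ν.totalVariation ≤ m := by
      refine iSup_le fun r => Measure.le_iff.2 fun A hA => ?_
      rw [Measure.ofMeasurable_apply A hA]
      exact le_iSup (fun r : Set.Ioi (0 : ℝ) => (ν.trunc r).variation A) r
    refine (hm B).trans_eq ?_
    exact Measure.ofMeasurable_apply B hB
  · exact iSup_le fun r =>
      (le_iSup (fun r : Set.Ioi (0 : ℝ) => (ν.trunc r).variation) r) B

/-- `ν.HasIntegral f I`: the function `f` is integrable with respect to `|ν|`, and
`∫ f dν = I`, the integral being the limit as `r ↓ 0` of the integrals of `f` against the finite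
complex measures `ν` restricted to `{x | r ≤ ‖x‖}`. -/
def HasIntegral (ν : ComplexLevyMeasure d) (f : EuclideanSpace ℝ (Fin d) → ℂ) (I : ℂ) : Prop :=
  Integrable f ν.totalVariation ∧
    Tendsto (fun r : ℝ => VectorMeasure.integral (ν.trunc r) f (ContinuousLinearMap.mul ℝ ℂ))
      (𝓝[>] 0) (𝓝 I)

end ComplexLevyMeasure

/-- The Lévy–Khintchine integrand `u ↦ e^{i⟨t,u⟩} - 1 - i⟨t,u⟩ / (1 + ‖u‖²)`. -/
noncomputable def levyIntegrand {d : ℕ} (t u : EuclideanSpace ℝ (Fin d)) : ℂ :=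
  expChar t u - 1 - Complex.I * ((inner ℝ t u : ℝ) : ℂ) / (1 + (‖u‖ : ℂ) ^ 2)

/-- The real vector `t` as an element of `ℂ^d`. -/
def toComplexVec {d : ℕ} (t : EuclideanSpace ℝ (Fin d)) : Fin d → ℂ := fun j => (t j : ℂ)

/-!
The implication from a lower bound for `|h|` to the exponential representation is the Wiener–Lévy
theorem for absolutely convergent almost periodic series. Its analytic core is
`coeffNorm_pow_le`: if a trigonometric polynomial `p` is bounded by `M` on `ℝ^d`, then the `ℓ¹`
norm of the coefficients of `p ^ n` is at most a polynomial in `n` times `M ^ n`. Indeed `p ^ n` has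
polynomially many frequencies, and Bessel's inequality bounds the `ℓ²` norm of its coefficients by
`M ^ n`. So the spectral radius in the `ℓ¹` algebra is the supremum on `ℝ^d`; Gelfand theory is not
needed. This has two consequences.

* A function with an absolutely convergent expansion and values in a disc of radius `ρ < 1` about
  `1` has a logarithm with an absolutely convergent expansion, because the logarithmic series
  converges in the `ℓ¹` norm (`HasAbsExpansion.exists_log`).
* A trigonometric polynomial with frequencies in a free group `ℤ^n`, bounded away from zero on
  `ℝ^d`, has no zeros on the torus (`lift_ne_zero_of_le_norm_trigPoly`).

On the torus a function without zeros is a character times the exponential of a continuous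
function, by lifting through the universal cover `ℝ^n`. The latter function is close to a
trigonometric polynomial by the Stone–Weierstrass theorem. Given `h` with `|h|` bounded below, these
facts apply to a trigonometric polynomial close to `h`, and the remaining factor of `h` is close to
`1` and has a logarithm (`HasAbsExpansion.exists_eq_expChar_mul_exp`).

The exponential representation is a Lévy–Khintchine representation with an atomic Lévy measure, and
its reciprocal expands by the exponential series. An absolutely convergent expansion of `1 / h`
bounds `1 / h`. A Lévy–Khintchine representation bounds `|h|` from below
(`exists_lower_bound_of_levyKhintchine`): the second differences of its exponent in direction `s`
are bounded uniformly in the base point, whence `|h(t+s)|² ≤ K(s) |h(t)| |h(t+2s)|`; on the other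
hand, averaging `h` along a progression shows that `h` is not uniformly small on the translates of
a fixed finite set.
-/

/-! ### Characters of `ℝ^d` and averages along arithmetic progressions -/

section Characters

variable {d : ℕ}

lemma expChar_add_right (t u v : EuclideanSpace ℝ (Fin d)) :
    expChar t (u + v) = expChar t u * expChar t v := by
  rw [expChar, expChar, expChar, ← Complex.exp_add, inner_add_right]
  push_cast
  ring_nf

lemma expChar_add_left (t s u : EuclideanSpace ℝ (Fin d)) :
    expChar (t + s) u = expChar t u * expChar s u := by
  rw [expChar, expChar, expChar, ← Complex.exp_add, inner_add_left]
  push_cast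
  ring_nf

@[simp] lemma expChar_zero_right (t : EuclideanSpace ℝ (Fin d)) : expChar t 0 = 1 := by
  simp [expChar]

@[simp] lemma expChar_zero_left (u : EuclideanSpace ℝ (Fin d)) : expChar 0 u = 1 := by
  simp [expChar]

@[simp] lemma norm_expChar (t u : EuclideanSpace ℝ (Fin d)) : ‖expChar t u‖ = 1 := by
  rw [expChar, mul_comm, Complex.norm_exp_ofReal_mul_I]

lemma expChar_neg_right (t u : EuclideanSpace ℝ (Fin d)) :
    expChar t (-u) = (starRingEnd ℂ) (expChar t u) := by
  rw [expChar, expChar, ← Complex.exp_conj]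
  simp

lemma expChar_neg_left (t u : EuclideanSpace ℝ (Fin d)) :
    expChar (-t) u = (starRingEnd ℂ) (expChar t u) := by
  rw [expChar, expChar, ← Complex.exp_conj]
  simp

lemma expChar_sub_right (t u v : EuclideanSpace ℝ (Fin d)) :
    expChar t (u - v) = expChar t u * (starRingEnd ℂ) (expChar t v) := by
  rw [sub_eq_add_neg, expChar_add_right, expChar_neg_right]

lemma expChar_nsmul_left (k : ℕ) (s u : EuclideanSpace ℝ (Fin d)) :
    expChar (k • s) u = expChar s u ^ k := by
  induction k with
  | zero => simp
  | succ k ih => rw [succ_nsmul, expChar_add_left, ih, pow_succ]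

lemma continuous_expChar_right (t : EuclideanSpace ℝ (Fin d)) : Continuous (expChar t) := by
  unfold expChar
  fun_prop

/-- Finitely many nonzero frequencies are simultaneously detected by one point `s`: a generic
direction has nonzero inner product with all of them, and is then scaled so that these inner
products are at most `1 < 2π`. -/
lemma exists_expChar_ne_one (F : Finset (EuclideanSpace ℝ (Fin d))) (hF : 0 ∉ F) :
    ∃ s, ∀ w ∈ F, expChar s w ≠ 1 := by
  obtain ⟨x, hx⟩ := Module.Dual.exists_forall_ne_zero_of_forall_exists
    (fun w : F => (innerₗ (EuclideanSpace ℝ (Fin d)) (w : EuclideanSpace ℝ (Fin d)))) (by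
      intro w
      refine ⟨w, ?_⟩
      have : (w : EuclideanSpace ℝ (Fin d)) ≠ 0 := fun h => hF (h ▸ w.2)
      simpa using this)
  set C : ℝ := 1 + ∑ w ∈ F, |inner ℝ w x| with hC
  have hC1 : 0 < C := by positivity
  refine ⟨C⁻¹ • x, fun w hw h1 => ?_⟩
  have hw0 : (inner ℝ w x : ℝ) ≠ 0 := by simpa using hx ⟨w, hw⟩
  have hle : |inner ℝ w x| ≤ C := by
    have := Finset.single_le_sum (f := fun w => |(inner ℝ w x : ℝ)|)
      (fun i _ => abs_nonneg _) hw
    linarith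
  rw [expChar, Complex.exp_eq_one_iff] at h1
  obtain ⟨n, hn⟩ := h1
  rw [real_inner_smul_left, real_inner_comm] at hn
  have h2 : C⁻¹ * inner ℝ w x = n * (2 * Real.pi) := by
    have : Complex.I * (((C⁻¹ * inner ℝ w x : ℝ) : ℂ) - ((n * (2 * Real.pi) : ℝ) : ℂ)) = 0 := by
      rw [mul_sub, hn]
      push_cast
      ring
    rcases mul_eq_zero.1 this with h | h
    · exact absurd h Complex.I_ne_zero
    · exact_mod_cast sub_eq_zero.1 h
  have h3 : |C⁻¹ * inner ℝ w x| ≤ 1 := by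
    rw [abs_mul, abs_of_pos (inv_pos.2 hC1), inv_mul_le_iff₀ hC1]
    simpa using hle
  have hn0 : n ≠ 0 := by
    rintro rfl
    simp [hw0, hC1.ne'] at h2
  have h4 : (1 : ℝ) ≤ |(n : ℝ)| := by exact_mod_cast Int.one_le_abs hn0
  rw [h2, abs_mul, abs_of_pos (by positivity : (0 : ℝ) < 2 * Real.pi)] at h3
  nlinarith [Real.pi_gt_three]

lemma tendsto_average_pow {z : ℂ} (hz : ‖z‖ = 1) (hz1 : z ≠ 1) :
    Tendsto (fun N : ℕ => (N : ℂ)⁻¹ * ∑ k ∈ Finset.range N, z ^ k) atTop (𝓝 0) := by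
  refine squeeze_zero_norm (a := fun N : ℕ => (N : ℝ)⁻¹ * (2 / ‖z - 1‖)) (fun N => ?_) ?_
  · rw [norm_mul, norm_inv, Complex.norm_natCast, geom_sum_eq hz1, norm_div]
    gcongr
    calc ‖z ^ N - 1‖ ≤ ‖z ^ N‖ + ‖(1 : ℂ)‖ := norm_sub_le _ _
      _ = 2 := by rw [norm_pow, hz]; norm_num
  · simpa using (tendsto_inv_atTop_nhds_zero_nat (𝕜 := ℝ)).mul_const (2 / ‖z - 1‖)

/-- A progression `0, s, 2s, …` along which the characters with the nonzero frequencies in `F`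
average to zero. It serves as an elementary substitute for the Bohr mean. -/
lemma exists_tendsto_average (F : Finset (EuclideanSpace ℝ (Fin d))) (hF : 0 ∉ F) :
    ∃ s, ∀ w ∈ F, Tendsto
      (fun N : ℕ => (N : ℂ)⁻¹ * ∑ k ∈ Finset.range N, expChar (k • s) w) atTop (𝓝 0) := by
  obtain ⟨s, hs⟩ := exists_expChar_ne_one F hF
  refine ⟨s, fun w hw => ?_⟩
  simp_rw [expChar_nsmul_left]
  exact tendsto_average_pow (norm_expChar s w) (hs w hw)

lemma tendsto_average_const (c : ℂ) :
    Tendsto (fun N : ℕ => (N : ℂ)⁻¹ * ∑ _k ∈ Finset.range N, c) atTop (𝓝 c) := by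
  refine tendsto_const_nhds.congr' ?_
  filter_upwards [eventually_ne_atTop 0] with N hN
  have : (N : ℂ) ≠ 0 := by exact_mod_cast hN
  simp [this]

/-- Bessel's inequality: the sum of the squared coefficients of a trigonometric polynomial with
distinct frequencies is at most the square of its supremum. -/
lemma sum_sq_le_of_norm_trigSum_le {ι : Type*} (U : Finset ι) (c : ι → ℂ)
    (x : ι → EuclideanSpace ℝ (Fin d)) (hx : Set.InjOn x U) {M : ℝ}
    (hM : ∀ t, ‖∑ i ∈ U, c i * expChar t (x i)‖ ≤ M) :
    ∑ i ∈ U, ‖c i‖ ^ 2 ≤ M ^ 2 := by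
  classical
  obtain ⟨s, hs⟩ := exists_tendsto_average
    (((U ×ˢ U).image fun ij => x ij.1 - x ij.2).erase 0) (by simp)
  set A : ℕ → ℂ := fun N => (N : ℂ)⁻¹ * ∑ k ∈ Finset.range N,
    (∑ i ∈ U, c i * expChar (k • s) (x i)) *
      (starRingEnd ℂ) (∑ i ∈ U, c i * expChar (k • s) (x i)) with hA
  have hAeq : A = fun N : ℕ => ∑ i ∈ U, ∑ j ∈ U, (c i * (starRingEnd ℂ) (c j)) *
      ((N : ℂ)⁻¹ * ∑ k ∈ Finset.range N, expChar (k • s) (x i - x j)) := by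
    funext N
    have hk : ∀ k : ℕ, (∑ i ∈ U, c i * expChar (k • s) (x i)) *
        (starRingEnd ℂ) (∑ i ∈ U, c i * expChar (k • s) (x i)) =
        ∑ i ∈ U, ∑ j ∈ U, (c i * (starRingEnd ℂ) (c j)) * expChar (k • s) (x i - x j) := by
      intro k
      rw [map_sum, Finset.sum_mul_sum]
      refine Finset.sum_congr rfl fun i _ => Finset.sum_congr rfl fun j _ => ?_
      rw [expChar_sub_right, map_mul]
      ring
    simp only [hA, hk]
    rw [Finset.sum_comm, Finset.mul_sum]
    refine Finset.sum_congr rfl fun i _ => ?_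
    rw [Finset.sum_comm, Finset.mul_sum]
    refine Finset.sum_congr rfl fun j _ => ?_
    rw [← Finset.mul_sum]
    ring
  have hlim : Tendsto A atTop (𝓝 (∑ i ∈ U, ∑ j ∈ U,
      (c i * (starRingEnd ℂ) (c j)) * (if i = j then 1 else 0))) := by
    rw [hAeq]
    refine tendsto_finsetSum _ fun i hi => tendsto_finsetSum _ fun j hj => ?_
    refine Tendsto.const_mul _ ?_
    split_ifs with hij
    · subst hij
      simpa using tendsto_average_const 1
    · refine hs _ (Finset.mem_erase.2 ⟨?_, Finset.mem_image.2 ⟨(i, j), by simp [hi, hj], rfl⟩⟩)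
      exact fun h => hij (hx hi hj (sub_eq_zero.1 h))
  have hbound : ∀ N, ‖A N‖ ≤ M ^ 2 := by
    intro N
    rw [hA]
    simp only [norm_mul, norm_inv, Complex.norm_natCast]
    have h1 : ‖∑ k ∈ Finset.range N, (∑ i ∈ U, c i * expChar (k • s) (x i)) *
      (starRingEnd ℂ) (∑ i ∈ U, c i * expChar (k • s) (x i))‖ ≤ N * M ^ 2 := by
      refine (norm_sum_le_of_le (Finset.range N) (f := fun k : ℕ =>
        (∑ i ∈ U, c i * expChar (k • s) (x i)) *
          (starRingEnd ℂ) (∑ i ∈ U, c i * expChar (k • s) (x i)))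
        (n := fun _ => M ^ 2) fun k _ => ?_).trans (by simp)
      rw [norm_mul, RCLike.norm_conj, ← sq]
      exact pow_le_pow_left₀ (norm_nonneg _) (hM _) 2
    rcases Nat.eq_zero_or_pos N with rfl | hN
    · simp [sq_nonneg]
    · rw [inv_mul_le_iff₀ (by exact_mod_cast hN)]
      exact h1
  have hle := le_of_tendsto hlim.norm (Eventually.of_forall hbound)
  have hval : (∑ i ∈ U, ∑ j ∈ U, (c i * (starRingEnd ℂ) (c j)) * (if i = j then 1 else 0) : ℂ)
      = ((∑ i ∈ U, ‖c i‖ ^ 2 : ℝ) : ℂ) := by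
    push_cast
    refine Finset.sum_congr rfl fun i hi => ?_
    simp [hi, Complex.mul_conj, Complex.normSq_eq_norm_sq]
  rw [hval, Complex.norm_real, Real.norm_of_nonneg (by positivity)] at hle
  exact hle

end Characters

/-! ### Powers of trigonometric polynomials -/

section Polynomials

variable {d : ℕ} {G : Type*} [AddCommGroup G]

/-- The character `u ↦ e^{i⟨t, φ u⟩}` of an abelian group `G` mapped to `ℝ^d` by `φ`. -/
noncomputable def expCharHom (φ : G →+ EuclideanSpace ℝ (Fin d)) (t : EuclideanSpace ℝ (Fin d)) :
    Multiplicative G →* ℂ where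
  toFun u := expChar t (φ u.toAdd)
  map_one' := by simp
  map_mul' u v := by simp [expChar_add_right]

/-- The trigonometric polynomial `t ↦ ∑ p_u e^{i⟨t, φ u⟩}` whose coefficients form the element `p`
of the group algebra of `G`. -/
noncomputable def trigPoly (φ : G →+ EuclideanSpace ℝ (Fin d)) (p : AddMonoidAlgebra ℂ G)
    (t : EuclideanSpace ℝ (Fin d)) : ℂ :=
  AddMonoidAlgebra.lift ℂ ℂ G (expCharHom φ t) p

/-- The `ℓ¹` norm of the coefficients of an element of the group algebra. -/
noncomputable def coeffNorm (p : AddMonoidAlgebra ℂ G) : ℝ :=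
  ∑ u ∈ p.coeff.support, ‖p.coeff u‖

lemma trigPoly_eq_sum (φ : G →+ EuclideanSpace ℝ (Fin d)) (p : AddMonoidAlgebra ℂ G)
    (t : EuclideanSpace ℝ (Fin d)) :
    trigPoly φ p t = ∑ u ∈ p.coeff.support, p.coeff u * expChar t (φ u) := by
  rw [trigPoly, AddMonoidAlgebra.lift_apply]
  rfl

lemma norm_lift_le_coeffNorm {χ : Multiplicative G →* ℂ} (hχ : ∀ u, ‖χ u‖ ≤ 1)
    (p : AddMonoidAlgebra ℂ G) : ‖AddMonoidAlgebra.lift ℂ ℂ G χ p‖ ≤ coeffNorm p := by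
  rw [AddMonoidAlgebra.lift_apply]
  refine norm_sum_le_of_le _ fun u _ => ?_
  rw [norm_smul]
  exact mul_le_of_le_one_right (norm_nonneg _) (hχ _)

lemma norm_trigPoly_le_coeffNorm (φ : G →+ EuclideanSpace ℝ (Fin d)) (p : AddMonoidAlgebra ℂ G)
    (t : EuclideanSpace ℝ (Fin d)) : ‖trigPoly φ p t‖ ≤ coeffNorm p :=
  norm_lift_le_coeffNorm (fun _ => (norm_expChar _ _).le) p

/-- The supports of the powers of `p` grow polynomially: `p ^ n` is supported on the sums
`∑ a_u u` with multiplicities `a_u ≤ n` for `u` in the support of `p`. -/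
lemma card_support_pow_le (p : AddMonoidAlgebra ℂ G) (n : ℕ) :
    (p ^ n).coeff.support.card ≤ (n + 1) ^ p.coeff.support.card := by
  classical
  set S := p.coeff.support with hS
  let B : ℕ → Finset G := fun n =>
    (Fintype.piFinset fun _ : S => Finset.range (n + 1)).image fun a => ∑ u : S, a u • (u : G)
  have hsub : ∀ n, (p ^ n).coeff.support ⊆ B n := by
    intro n
    induction n with
    | zero =>
      intro u hu
      rw [pow_zero] at hu
      have : u = 0 := Finset.mem_singleton.1 (Finsupp.support_single_subset hu)
      exact Finset.mem_image.2 ⟨fun _ => 0, by simp, by simp [this]⟩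
    | succ n ih =>
      intro u hu
      rw [pow_succ] at hu
      obtain ⟨v, hv, w, hw, rfl⟩ :=
        Finset.mem_add.1 (AddMonoidAlgebra.support_coeff_mul_subset _ _ hu)
      obtain ⟨a, ha, rfl⟩ := Finset.mem_image.1 (ih hv)
      refine Finset.mem_image.2 ⟨a + Pi.single ⟨w, hw⟩ 1, ?_, ?_⟩
      · rw [Fintype.mem_piFinset] at ha ⊢
        intro x
        have := Finset.mem_range.1 (ha x)
        rw [Finset.mem_range, Pi.add_apply, Pi.single_apply]
        split_ifs <;> omega
      · simp only [Pi.add_apply, add_smul, Finset.sum_add_distrib]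
        congr 1
        rw [Finset.sum_eq_single ⟨w, hw⟩]
        · simp
        · intro b _ hb
          simp [hb]
        · simp
  refine (Finset.card_le_card (hsub n)).trans (Finset.card_image_le.trans ?_)
  simp

/-- If `p` is bounded by `M` on `ℝ^d`, then the `ℓ¹` norm of `p ^ n` is at most a polynomial in
`n` times `M ^ n`, by Bessel's inequality and the Cauchy–Schwarz inequality on the support. -/
lemma coeffNorm_pow_le {φ : G →+ EuclideanSpace ℝ (Fin d)} (hφ : Function.Injective φ)
    (p : AddMonoidAlgebra ℂ G) {M : ℝ} (hM : ∀ t, ‖trigPoly φ p t‖ ≤ M) (n : ℕ) :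
    coeffNorm (p ^ n) ≤ ((n : ℝ) + 1) ^ p.coeff.support.card * M ^ n := by
  have hM0 : 0 ≤ M := (norm_nonneg _).trans (hM 0)
  have h1 := sum_sq_le_of_norm_trigSum_le (p ^ n).coeff.support (p ^ n).coeff φ hφ.injOn
    (M := M ^ n) (fun t => by
      rw [← trigPoly_eq_sum, trigPoly, map_pow, norm_pow]
      exact pow_le_pow_left₀ (norm_nonneg _) (hM t) n)
  have h2 := sq_sum_le_card_mul_sum_sq (s := (p ^ n).coeff.support)
    (f := fun u => ‖(p ^ n).coeff u‖)
  have h3 : ((p ^ n).coeff.support.card : ℝ) ≤ ((n : ℝ) + 1) ^ p.coeff.support.card := by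
    exact_mod_cast card_support_pow_le p n
  have h4 : (1 : ℝ) ≤ ((n : ℝ) + 1) ^ p.coeff.support.card :=
    one_le_pow₀ (by linarith [n.cast_nonneg (α := ℝ)])
  refine le_of_sq_le_sq ?_ (by positivity)
  calc coeffNorm (p ^ n) ^ 2
      ≤ (p ^ n).coeff.support.card * ∑ u ∈ (p ^ n).coeff.support, ‖(p ^ n).coeff u‖ ^ 2 := h2
    _ ≤ ((n : ℝ) + 1) ^ p.coeff.support.card * (M ^ n) ^ 2 := by gcongr
    _ ≤ (((n : ℝ) + 1) ^ p.coeff.support.card) ^ 2 * (M ^ n) ^ 2 := by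
      gcongr
      exact le_self_pow₀ h4 two_ne_zero
    _ = _ := by ring

lemma tendsto_succ_pow_mul_pow (k : ℕ) {r : ℝ} (h0 : 0 ≤ r) (h1 : r < 1) :
    Tendsto (fun n : ℕ => ((n : ℝ) + 1) ^ k * r ^ n) atTop (𝓝 0) := by
  rcases h0.eq_or_lt with rfl | hr
  · refine tendsto_const_nhds.congr' ?_
    filter_upwards [eventually_ne_atTop 0] with n hn
    simp [hn]
  · have h := (tendsto_add_atTop_iff_nat 1).2
      (tendsto_pow_const_mul_const_pow_of_abs_lt_one k (r := r) (by rwa [abs_of_pos hr]))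
    have h' := h.const_mul r⁻¹
    rw [mul_zero] at h'
    refine h'.congr fun n => ?_
    push_cast
    field_simp
    ring

/-- A bound for a trigonometric polynomial on `ℝ^d` is a bound for its value at every character of
the group of frequencies: the `ℓ¹` norms of the powers of `p` bound both. This replaces
Kronecker's theorem on the density of `ℝ^d` in the dual group. -/
lemma norm_lift_le_of_norm_trigPoly_le {φ : G →+ EuclideanSpace ℝ (Fin d)}
    (hφ : Function.Injective φ) (p : AddMonoidAlgebra ℂ G) {M : ℝ}
    (hM : ∀ t, ‖trigPoly φ p t‖ ≤ M) {χ : Multiplicative G →* ℂ} (hχ : ∀ u, ‖χ u‖ ≤ 1) :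
    ‖AddMonoidAlgebra.lift ℂ ℂ G χ p‖ ≤ M := by
  have hM0 : 0 ≤ M := (norm_nonneg _).trans (hM 0)
  set a := ‖AddMonoidAlgebra.lift ℂ ℂ G χ p‖ with ha
  by_contra! hlt
  have ha0 : 0 < a := hM0.trans_lt hlt
  have h1 : ∀ n : ℕ, 1 ≤ ((n : ℝ) + 1) ^ p.coeff.support.card * (M / a) ^ n := by
    intro n
    have : a ^ n ≤ ((n : ℝ) + 1) ^ p.coeff.support.card * M ^ n := by
      rw [ha, ← norm_pow, ← map_pow]
      exact (norm_lift_le_coeffNorm hχ _).trans (coeffNorm_pow_le hφ p hM n)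
    rw [div_pow, ← mul_div_assoc, le_div_iff₀ (by positivity), one_mul]
    exact this
  have h2 := ge_of_tendsto (tendsto_succ_pow_mul_pow p.coeff.support.card (r := M / a)
    (by positivity) ((div_lt_one ha0).2 hlt)) (Eventually.of_forall h1)
  linarith

end Polynomials

/-! ### Absolutely convergent expansions -/

section Expansions

variable {d : ℕ}

/-- `HasAbsExpansion H f C`: the function `f` on `ℝ^d` is a sum `∑ a_i e^{i⟨t, x_i⟩}` with all
frequencies `x_i` in the group `H` and `∑ |a_i| ≤ C`. The frequencies may repeat and the index type
is arbitrary, so that sums and products of expansions need no regrouping. -/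
def HasAbsExpansion (H : AddSubgroup (EuclideanSpace ℝ (Fin d)))
    (f : EuclideanSpace ℝ (Fin d) → ℂ) (C : ℝ) : Prop :=
  ∃ (ι : Type) (a : ι → ℂ) (x : ι → EuclideanSpace ℝ (Fin d)), (∀ i, x i ∈ H) ∧
    (Summable fun i => ‖a i‖) ∧ ∑' i, ‖a i‖ ≤ C ∧ ∀ t, f t = ∑' i, a i * expChar t (x i)

lemma summable_norm_mul_expChar {ι : Type*} {a : ι → ℂ} (ha : Summable fun i => ‖a i‖)
    (x : ι → EuclideanSpace ℝ (Fin d)) (t : EuclideanSpace ℝ (Fin d)) :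
    Summable fun i => ‖a i * expChar t (x i)‖ := by
  simpa using ha

namespace HasAbsExpansion

variable {H : AddSubgroup (EuclideanSpace ℝ (Fin d))} {f g : EuclideanSpace ℝ (Fin d) → ℂ}
  {C D : ℝ}

lemma congr (hf : HasAbsExpansion H f C) (h : ∀ t, g t = f t) : HasAbsExpansion H g C :=
  (funext h : g = f) ▸ hf

lemma mono (hf : HasAbsExpansion H f C) (h : C ≤ D) : HasAbsExpansion H f D := by
  obtain ⟨ι, a, x, hx, ha, hC, hfa⟩ := hf
  exact ⟨ι, a, x, hx, ha, hC.trans h, hfa⟩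

lemma norm_le (hf : HasAbsExpansion H f C) (t : EuclideanSpace ℝ (Fin d)) : ‖f t‖ ≤ C := by
  obtain ⟨ι, a, x, -, ha, hC, hfa⟩ := hf
  rw [hfa]
  refine (norm_tsum_le_tsum_norm (summable_norm_mul_expChar ha x t)).trans ?_
  simpa using hC

lemma nonneg (hf : HasAbsExpansion H f C) : 0 ≤ C := (norm_nonneg _).trans (hf.norm_le 0)

lemma const_mul_expChar (c : ℂ) {u : EuclideanSpace ℝ (Fin d)} (hu : u ∈ H) :
    HasAbsExpansion H (fun t => c * expChar t u) ‖c‖ :=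
  ⟨Unit, fun _ => c, fun _ => u, fun _ => hu, (hasSum_fintype _).summable, by simp, by simp⟩

lemma const (H : AddSubgroup (EuclideanSpace ℝ (Fin d))) (c : ℂ) :
    HasAbsExpansion H (fun _ => c) ‖c‖ :=
  (const_mul_expChar c H.zero_mem).congr (by simp)

lemma tsum {J : Type} {f : J → EuclideanSpace ℝ (Fin d) → ℂ} {C : J → ℝ}
    (hf : ∀ j, HasAbsExpansion H (f j) (C j)) (hC : Summable C) :
    HasAbsExpansion H (fun t => ∑' j, f j t) (∑' j, C j) := by
  choose ι a x hx ha haC hfa using hf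
  have hS : Summable fun j => ∑' i, ‖a j i‖ :=
    hC.of_nonneg_of_le (fun j => tsum_nonneg fun i => norm_nonneg _) haC
  have hsig : Summable fun y : Σ j, ι j => ‖a y.1 y.2‖ :=
    (summable_sigma_of_nonneg fun _ => norm_nonneg _).2 ⟨ha, hS⟩
  refine ⟨Σ j, ι j, fun y => a y.1 y.2, fun y => x y.1 y.2, fun y => hx y.1 y.2, hsig, ?_, ?_⟩
  · rw [hsig.tsum_sigma]
    exact hS.tsum_le_tsum haC hC
  · intro t
    rw [(summable_norm_mul_expChar hsig (fun y : Σ j, ι j => x y.1 y.2) t).of_norm.tsum_sigma]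
    exact tsum_congr fun j => hfa j t

lemma sum {J : Type} (s : Finset J) {f : J → EuclideanSpace ℝ (Fin d) → ℂ} {C : J → ℝ}
    (hf : ∀ j ∈ s, HasAbsExpansion H (f j) (C j)) :
    HasAbsExpansion H (fun t => ∑ j ∈ s, f j t) (∑ j ∈ s, C j) := by
  have h := tsum (J := s) (fun j => hf j j.2) (hasSum_fintype _).summable
  rw [Finset.tsum_subtype s C] at h
  exact h.congr fun t => (Finset.tsum_subtype s fun j => f j t).symm

lemma add (hf : HasAbsExpansion H f C) (hg : HasAbsExpansion H g D) :
    HasAbsExpansion H (fun t => f t + g t) (C + D) := by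
  have h := sum (H := H) (J := Bool) Finset.univ (f := fun b => cond b f g)
    (C := fun b => cond b C D) (by rintro (_ | _) -; exacts [hg, hf])
  simpa using h

lemma mul (hf : HasAbsExpansion H f C) (hg : HasAbsExpansion H g D) :
    HasAbsExpansion H (fun t => f t * g t) (C * D) := by
  have hC0 := hf.nonneg
  obtain ⟨ι, a, x, hx, ha, hC, hfa⟩ := hf
  obtain ⟨κ, b, y, hy, hb, hD, hgb⟩ := hg
  refine ⟨ι × κ, fun z => a z.1 * b z.2, fun z => x z.1 + y z.2,
    fun z => H.add_mem (hx _) (hy _), ?_, ?_, ?_⟩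
  · simpa using summable_mul_of_summable_norm (f := fun i => ‖a i‖) (g := fun j => ‖b j‖)
      (by simpa using ha) (by simpa using hb)
  · have h := tsum_mul_tsum_of_summable_norm (f := fun i => ‖a i‖) (g := fun j => ‖b j‖)
      (by simpa using ha) (by simpa using hb)
    simp only [norm_mul]
    rw [← h]
    exact mul_le_mul hC hD (tsum_nonneg fun _ => norm_nonneg _) hC0
  · intro t
    beta_reduce
    rw [hfa, hgb, tsum_mul_tsum_of_summable_norm (summable_norm_mul_expChar ha x t)
      (summable_norm_mul_expChar hb y t)]
    refine tsum_congr fun z => ?_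
    rw [expChar_add_right]
    ring

lemma const_mul (c : ℂ) (hf : HasAbsExpansion H f C) :
    HasAbsExpansion H (fun t => c * f t) (‖c‖ * C) := (const H c).mul hf

lemma neg (hf : HasAbsExpansion H f C) : HasAbsExpansion H (fun t => -f t) C := by
  have h := hf.const_mul (-1)
  rw [norm_neg, norm_one, one_mul] at h
  exact h.congr fun t => (neg_one_mul _).symm

lemma sub (hf : HasAbsExpansion H f C) (hg : HasAbsExpansion H g D) :
    HasAbsExpansion H (fun t => f t - g t) (C + D) :=
  (hf.add hg.neg).congr fun _ => sub_eq_add_neg _ _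

lemma pow (hf : HasAbsExpansion H f C) (n : ℕ) : HasAbsExpansion H (fun t => f t ^ n) (C ^ n) := by
  induction n with
  | zero => simpa using const H 1
  | succ n ih => exact (ih.mul hf).congr fun t => pow_succ _ _

lemma exp (hf : HasAbsExpansion H f C) :
    HasAbsExpansion H (fun t => Complex.exp (f t)) (Real.exp C) := by
  have h := tsum (fun n : ℕ => (hf.pow n).const_mul ((n.factorial : ℂ)⁻¹)) (by
    refine (Real.summable_pow_div_factorial C).congr fun n => ?_
    rw [norm_inv, Complex.norm_natCast, inv_mul_eq_div])
  rw [Real.exp_eq_exp_ℝ, NormedSpace.exp_eq_tsum_div]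
  simp only [norm_inv, Complex.norm_natCast, inv_mul_eq_div] at h
  refine h.congr fun t => ?_
  rw [Complex.exp_eq_exp_ℂ, NormedSpace.exp_eq_tsum_div]

lemma of_trigPoly {G : Type} [AddCommGroup G] {φ : G →+ EuclideanSpace ℝ (Fin d)}
    (hφ : ∀ u, φ u ∈ H) (p : AddMonoidAlgebra ℂ G) :
    HasAbsExpansion H (trigPoly φ p) (coeffNorm p) :=
  (sum p.coeff.support (C := fun u => ‖p.coeff u‖)
    fun u _ => const_mul_expChar (p.coeff u) (hφ u)).congr fun t => trigPoly_eq_sum _ p t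

/-- Truncating an expansion approximates it by a trigonometric polynomial, up to a remainder with
small coefficient sum. -/
lemma exists_trigPoly_sub (hf : HasAbsExpansion H f C) {ε : ℝ} (hε : 0 < ε) :
    ∃ p : AddMonoidAlgebra ℂ H,
      HasAbsExpansion H (fun t => f t - trigPoly H.subtype p t) ε := by
  classical
  obtain ⟨ι, a, x, hx, ha, hC, hfa⟩ := hf
  obtain ⟨s, hs⟩ :=
    ((tendsto_order.1 (tendsto_tsum_compl_atTop_zero fun i => ‖a i‖)).2 ε hε).exists
  refine ⟨∑ i ∈ s, AddMonoidAlgebra.single ⟨x i, hx i⟩ (a i), {i // i ∉ s}, fun i => a i,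
    fun i => x i, fun i => hx i, ha.subtype _, hs.le, fun t => ?_⟩
  have h1 : trigPoly H.subtype (∑ i ∈ s, AddMonoidAlgebra.single ⟨x i, hx i⟩ (a i)) t =
      ∑ i ∈ s, a i * expChar t (x i) := by
    rw [trigPoly, map_sum]
    refine Finset.sum_congr rfl fun i _ => ?_
    rw [AddMonoidAlgebra.lift_single]
    rfl
  beta_reduce
  rw [h1, hfa, ← (summable_norm_mul_expChar ha x t).of_norm.sum_add_tsum_subtype_compl s]
  ring

/-- The spectral radius of an absolutely convergent expansion is at most its supremum on `ℝ^d`: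
this is `coeffNorm_pow_le` for trigonometric polynomials, and a small remainder is absorbed by the
binomial theorem. -/
lemma exists_pow_bound (hf : HasAbsExpansion H f C) {ρ ε : ℝ} (hρ : ∀ t, ‖f t‖ ≤ ρ)
    (hε : 0 < ε) :
    ∃ K : ℕ, ∀ n : ℕ, HasAbsExpansion H (fun t => f t ^ n) (((n : ℝ) + 1) ^ K * (ρ + ε) ^ n) := by
  obtain ⟨p, hp⟩ := hf.exists_trigPoly_sub (half_pos hε)
  set e := fun t => f t - trigPoly H.subtype p t with he
  have hM : ∀ t, ‖trigPoly H.subtype p t‖ ≤ ρ + ε / 2 := by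
    intro t
    calc ‖trigPoly H.subtype p t‖ = ‖f t - e t‖ := by simp [he]
      _ ≤ ‖f t‖ + ‖e t‖ := norm_sub_le _ _
      _ ≤ ρ + ε / 2 := add_le_add (hρ t) (hp.norm_le t)
  have hM0 : 0 ≤ ρ + ε / 2 := (norm_nonneg _).trans (hM 0)
  refine ⟨p.coeff.support.card, fun n => ?_⟩
  have hterm : ∀ k ∈ Finset.range (n + 1), HasAbsExpansion H
      (fun t => (n.choose k : ℂ) * (trigPoly H.subtype (p ^ k) t * e t ^ (n - k)))
      ((((n : ℝ) + 1) ^ p.coeff.support.card) *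
        ((ρ + ε / 2) ^ k * (ε / 2) ^ (n - k) * n.choose k)) := by
    intro k hk
    refine (((of_trigPoly (fun u : H => u.2) (p ^ k)).mul (hp.pow (n - k))).const_mul
      (n.choose k : ℂ)).mono ?_
    have h1 := coeffNorm_pow_le H.subtype_injective p hM k
    have h2 : ((k : ℝ) + 1) ^ p.coeff.support.card ≤ ((n : ℝ) + 1) ^ p.coeff.support.card := by
      have : (k : ℝ) ≤ n := by exact_mod_cast Finset.mem_range_succ_iff.1 hk
      gcongr
    rw [Complex.norm_natCast]
    calc (n.choose k : ℝ) * (coeffNorm (p ^ k) * (ε / 2) ^ (n - k))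
        ≤ (n.choose k : ℝ) * ((((n : ℝ) + 1) ^ p.coeff.support.card * (ρ + ε / 2) ^ k) *
          (ε / 2) ^ (n - k)) := by
          gcongr
          exact h1.trans (by gcongr)
      _ = _ := by ring
  refine ((sum _ hterm).congr fun t => ?_).mono (le_of_eq ?_)
  · have : f t = trigPoly H.subtype p t + e t := by simp [he]
    rw [this, add_pow]
    refine Finset.sum_congr rfl fun k _ => ?_
    rw [trigPoly, trigPoly, map_pow]
    ring
  · rw [← Finset.mul_sum, ← add_pow]
    ring_nf

/-- A function with an absolutely convergent expansion whose values stay in a disc of radius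
`ρ < 1` about `1` has a logarithm with such an expansion: the logarithmic series converges
absolutely by the spectral radius bound. -/
lemma exists_log (hf : HasAbsExpansion H f C) {ρ : ℝ} (hρ1 : ρ < 1) (hρ : ∀ t, ‖f t - 1‖ ≤ ρ) :
    ∃ (a : EuclideanSpace ℝ (Fin d) → ℂ) (D : ℝ),
      HasAbsExpansion H a D ∧ ∀ t, f t = Complex.exp (a t) := by
  have hρ0 : 0 ≤ ρ := (norm_nonneg _).trans (hρ 0)
  obtain ⟨K, hK⟩ := (hf.sub (const H 1)).exists_pow_bound hρ (half_pos (sub_pos.2 hρ1))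
  set r := ρ + (1 - ρ) / 2 with hr
  have hr0 : 0 < r := by linarith
  have hr1 : r < 1 := by linarith
  have hsum : Summable fun n : ℕ => ((n : ℝ) + 1) ^ K * r ^ n := by
    have h := (summable_nat_add_iff 1).2
      (summable_pow_mul_geometric_of_norm_lt_one K (r := r) (by rwa [Real.norm_of_nonneg hr0.le]))
    refine (h.mul_left r⁻¹).congr fun n => ?_
    push_cast
    field_simp
    ring
  have hterm : ∀ n : ℕ, HasAbsExpansion H (fun t => ((-1) ^ (n + 1) / (n : ℂ)) * (f t - 1) ^ n)
      (((n : ℝ) + 1) ^ K * r ^ n) := by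
    intro n
    refine ((hK n).const_mul _).mono (mul_le_of_le_one_left (by positivity) ?_)
    rw [norm_div, norm_pow, norm_neg, norm_one, one_pow, Complex.norm_natCast]
    -- The term `n = 0` of the series is `1 / 0 = 0`.
    rcases Nat.eq_zero_or_pos n with rfl | hn
    · simp
    · exact (div_le_one (by positivity)).2 (by exact_mod_cast hn)
  refine ⟨_, _, tsum hterm hsum, fun t => ?_⟩
  have h1 : ‖f t - 1‖ < 1 := (hρ t).trans_lt hρ1
  have h2 := (Complex.hasSum_taylorSeries_log h1).tsum_eq
  have h3 : f t ≠ 0 := by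
    intro h0
    rw [h0] at h1
    norm_num at h1
  rw [add_sub_cancel] at h2
  refine (Complex.exp_log h3).symm.trans (congrArg Complex.exp (h2.symm.trans ?_))
  exact tsum_congr fun n => by ring

/-- Collecting equal frequencies turns an expansion into one indexed by the group `H`. -/
lemma exists_coeff (hf : HasAbsExpansion H f C) :
    ∃ q : EuclideanSpace ℝ (Fin d) → ℂ, (Summable fun u : H => ‖q u‖) ∧
      ∀ t, f t = ∑' u : H, q u * expChar t u := by
  obtain ⟨ι, a, x, hx, ha, -, hfa⟩ := hf
  let g : ι → H := fun i => ⟨x i, hx i⟩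
  have hq : ∀ u : H, ∑' i : {i // x i = (u : EuclideanSpace ℝ (Fin d))}, a i =
      ∑' i : g ⁻¹' {u}, a i := by
    intro u
    have : {i | x i = (u : EuclideanSpace ℝ (Fin d))} = g ⁻¹' {u} := by
      ext i
      simp [g, Subtype.ext_iff]
    exact congrArg (fun s : Set ι => ∑' i : s, a i) this
  refine ⟨fun u => ∑' i : {i // x i = u}, a i, ?_, fun t => ?_⟩
  · simp only [hq]
    refine (ha.hasSum.tsum_fiberwise g).summable.of_nonneg_of_le (fun _ => norm_nonneg _)
      fun u => norm_tsum_le_tsum_norm (ha.subtype _)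
  · rw [hfa, ← ((summable_norm_mul_expChar ha x t).of_norm.hasSum.tsum_fiberwise g).tsum_eq]
    refine tsum_congr fun u => ?_
    beta_reduce
    rw [hq, ← tsum_mul_right]
    refine tsum_congr fun i => ?_
    have : x i = u := congrArg Subtype.val i.2
    rw [this]

end HasAbsExpansion

end Expansions

/-! ### Trigonometric polynomials without zeros on the torus -/

section Torus

variable {d : ℕ} {G : Type*} [AddCommGroup G]

lemma map_neg_eq_conj {χ : Multiplicative G →* ℂ} (hχ : ∀ u, ‖χ u‖ = 1) (u : G) :
    χ (.ofAdd (-u)) = (starRingEnd ℂ) (χ (.ofAdd u)) := by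
  have h0 : χ (.ofAdd u) ≠ 0 := norm_ne_zero_iff.1 (by rw [hχ]; exact one_ne_zero)
  refine mul_right_cancel₀ h0 ?_
  rw [← map_mul, ← ofAdd_add, neg_add_cancel, ofAdd_zero, map_one, mul_comm, Complex.mul_conj,
    Complex.normSq_eq_norm_sq, hχ]
  norm_num

/-- The element of the group algebra whose values at unitary characters are the complex conjugates
of those of `p`. -/
noncomputable def conjReflect (p : AddMonoidAlgebra ℂ G) : AddMonoidAlgebra ℂ G :=
  ∑ u ∈ p.coeff.support, AddMonoidAlgebra.single (-u) ((starRingEnd ℂ) (p.coeff u))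

lemma lift_conjReflect {χ : Multiplicative G →* ℂ} (hχ : ∀ u, ‖χ u‖ = 1)
    (p : AddMonoidAlgebra ℂ G) :
    AddMonoidAlgebra.lift ℂ ℂ G χ (conjReflect p) =
      (starRingEnd ℂ) (AddMonoidAlgebra.lift ℂ ℂ G χ p) := by
  rw [conjReflect, map_sum, AddMonoidAlgebra.lift_apply, Finsupp.sum, map_sum]
  refine Finset.sum_congr rfl fun u _ => ?_
  rw [AddMonoidAlgebra.lift_single, map_neg_eq_conj hχ, smul_eq_mul, smul_eq_mul, map_mul]

/-- A trigonometric polynomial bounded away from zero on `ℝ^d` does not vanish at any unitary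
character of its group of frequencies. With `M` an upper bound of `|p|`, this compares the bounds
of `M² - |p|²` on `ℝ^d` and at the character. -/
lemma lift_ne_zero_of_le_norm_trigPoly {φ : G →+ EuclideanSpace ℝ (Fin d)}
    (hφ : Function.Injective φ) (p : AddMonoidAlgebra ℂ G) {c : ℝ} (hc : 0 < c)
    (hp : ∀ t, c ≤ ‖trigPoly φ p t‖) {χ : Multiplicative G →* ℂ} (hχ : ∀ u, ‖χ u‖ = 1) :
    AddMonoidAlgebra.lift ℂ ℂ G χ p ≠ 0 := by
  intro h0
  set M := coeffNorm p with hM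
  set w : AddMonoidAlgebra ℂ G :=
    AddMonoidAlgebra.single 0 ((M ^ 2 : ℝ) : ℂ) - p * conjReflect p with hw
  have hval : ∀ {ψ : Multiplicative G →* ℂ}, (∀ u, ‖ψ u‖ = 1) →
      AddMonoidAlgebra.lift ℂ ℂ G ψ w =
        ((M ^ 2 - ‖AddMonoidAlgebra.lift ℂ ℂ G ψ p‖ ^ 2 : ℝ) : ℂ) := by
    intro ψ hψ
    rw [hw, map_sub, map_mul, lift_conjReflect hψ, AddMonoidAlgebra.lift_single, Complex.mul_conj,
      Complex.normSq_eq_norm_sq, ofAdd_zero, map_one, smul_eq_mul, mul_one, Complex.ofReal_sub]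
  have hbound : ∀ t, ‖trigPoly φ w t‖ ≤ M ^ 2 - c ^ 2 := by
    intro t
    have h1 : ‖trigPoly φ p t‖ ≤ M := norm_trigPoly_le_coeffNorm φ p t
    rw [trigPoly, hval fun u => norm_expChar _ _, Complex.norm_real, Real.norm_of_nonneg]
    · have := pow_le_pow_left₀ hc.le (hp t) 2
      rw [trigPoly] at this
      linarith
    · have := pow_le_pow_left₀ (norm_nonneg _) h1 2
      rw [trigPoly] at this
      linarith
  have h2 := norm_lift_le_of_norm_trigPoly_le hφ w hbound fun u => (hχ u).le
  rw [hval hχ, h0, norm_zero, Complex.norm_real, Real.norm_of_nonneg (by simpa using sq_nonneg M)]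
    at h2
  have := pow_pos hc 2
  linarith

variable {n : ℕ}

/-- The character of `ℤ^n` given by a point of the torus. -/
noncomputable def torusHom (x : UnitAddTorus (Fin n)) : Multiplicative (Fin n → ℤ) →* ℂ where
  toFun m := UnitAddTorus.mFourier m.toAdd x
  map_one' := by simp [UnitAddTorus.mFourier_zero]
  map_mul' u v := UnitAddTorus.mFourier_add

lemma norm_torusHom (x : UnitAddTorus (Fin n)) (u : Multiplicative (Fin n → ℤ)) :
    ‖torusHom x u‖ = 1 := by
  change ‖∏ i, fourier _ _‖ = 1
  rw [norm_prod]
  exact Finset.prod_eq_one fun i _ => Circle.norm_coe _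

lemma mFourier_coe (m : Fin n → ℤ) (θ : Fin n → ℝ) :
    UnitAddTorus.mFourier m (fun i => (θ i : UnitAddCircle)) =
      Complex.exp (2 * Real.pi * Complex.I * ∑ i, (m i : ℂ) * θ i) := by
  change ∏ i, fourier (m i) (θ i : UnitAddCircle) = _
  simp_rw [fourier_coe_apply]
  rw [← Complex.exp_sum, Finset.mul_sum]
  congr 1
  refine Finset.sum_congr rfl fun i _ => ?_
  push_cast
  ring

/-- Every point `t` of `ℝ^d` acts on the frequency group `φ(ℤ^n)` as a point of the torus. -/
lemma exists_torusHom_eq_expCharHom (φ : (Fin n → ℤ) →+ EuclideanSpace ℝ (Fin d))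
    (t : EuclideanSpace ℝ (Fin d)) : ∃ x : UnitAddTorus (Fin n), torusHom x = expCharHom φ t := by
  refine ⟨fun i => ((inner ℝ t (φ (Pi.single i 1)) / (2 * Real.pi) : ℝ) : UnitAddCircle), ?_⟩
  refine MonoidHom.ext fun m => ?_
  revert m
  change ∀ m : Fin n → ℤ, UnitAddTorus.mFourier m _ = expChar t (φ m)
  intro m
  have hm : φ m = ∑ i, (m i : ℝ) • φ (Pi.single i 1) := by
    conv_lhs => rw [← Finset.univ_sum_single m, map_sum]
    refine Finset.sum_congr rfl fun i _ => ?_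
    have : Pi.single i (m i) = m i • (Pi.single i 1 : Fin n → ℤ) := by
      rw [← Pi.single_smul, smul_eq_mul, mul_one]
    rw [Int.cast_smul_eq_zsmul, ← map_zsmul, this]
  rw [mFourier_coe, hm, expChar, inner_sum Finset.univ]
  congr 1
  simp only [inner_smul_right]
  push_cast
  rw [Finset.mul_sum, Finset.mul_sum]
  refine Finset.sum_congr rfl fun i _ => ?_
  field_simp

lemma continuous_lift_torusHom (p : AddMonoidAlgebra ℂ (Fin n → ℤ)) :
    Continuous fun x : UnitAddTorus (Fin n) =>
      AddMonoidAlgebra.lift ℂ ℂ (Fin n → ℤ) (torusHom x) p := by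
  simp_rw [AddMonoidAlgebra.lift_apply]
  exact continuous_finsetSum _ fun m _ =>
    (UnitAddTorus.mFourier m).continuous.const_smul (p.coeff m)

/-- The projection from `ℝ^n` to the torus. -/
def torusProj : C(Fin n → ℝ, UnitAddTorus (Fin n)) where
  toFun θ i := (θ i : UnitAddCircle)
  continuous_toFun := continuous_pi fun i =>
    (AddCircle.continuous_mk' (1 : ℝ)).comp (continuous_apply i)

lemma isQuotientMap_torusProj : IsQuotientMap (torusProj (n := n)) :=
  (IsOpenQuotientMap.piMap fun _ : Fin n =>
    (QuotientAddGroup.isOpenQuotientMap_mk (N := AddSubgroup.zmultiples (1 : ℝ)))).isQuotientMap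

lemma torusProj_eq_iff {θ η : Fin n → ℝ} :
    torusProj θ = torusProj η ↔ ∃ k : Fin n → ℤ, η = θ + fun i => (k i : ℝ) := by
  constructor
  · intro h
    have h1 : ∀ i, ∃ k : ℤ, η i = θ i + k := by
      intro i
      have h2 : ((η i - θ i : ℝ) : UnitAddCircle) = 0 := by
        rw [AddCircle.coe_sub, sub_eq_zero]
        exact (congrFun h i).symm
      obtain ⟨k, hk⟩ := (AddCircle.coe_eq_zero_iff _).1 h2
      refine ⟨k, ?_⟩
      rw [zsmul_eq_mul, mul_one] at hk
      linarith
    choose k hk using h1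
    exact ⟨k, funext hk⟩
  · rintro ⟨k, rfl⟩
    funext i
    change (θ i : UnitAddCircle) = ((θ i + k i : ℝ) : UnitAddCircle)
    rw [AddCircle.coe_add, left_eq_add]
    exact (AddCircle.coe_eq_zero_iff _).2 ⟨k i, by simp⟩

/-- A continuous function without zeros on the torus is a character times the exponential of a
continuous function: its logarithm on the universal cover `ℝ^n` changes by a homomorphism
`ℤ^n → 2πiℤ` under the deck transformations. -/
lemma exists_eq_mFourier_mul_exp {F : UnitAddTorus (Fin n) → ℂ} (hF : Continuous F)
    (hF0 : ∀ x, F x ≠ 0) :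
    ∃ (m : Fin n → ℤ) (Ψ : C(UnitAddTorus (Fin n), ℂ)),
      ∀ x, F x = UnitAddTorus.mFourier m x * Complex.exp (Ψ x) := by
  have hπ := isQuotientMap_torusProj (n := n)
  have hUc : IsSimplyConnected (Set.univ : Set (Fin n → ℝ)) := by
    have : ContractibleSpace (Set.univ : Set (Fin n → ℝ)) :=
      convex_univ.contractibleSpace Set.univ_nonempty
    exact SimplyConnectedSpace.ofContractible _
  obtain ⟨g, hgc, hg⟩ := Complex.exists_continuousOn_eqOn_exp_comp
    (U := (Set.univ : Set (Fin n → ℝ))) (g := fun θ => F (torusProj θ))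
    hUc isOpen_univ (hF.comp hπ.continuous).continuousOn (by simpa using fun θ => hF0 _)
  rw [continuousOn_univ] at hgc
  replace hg : ∀ θ, Complex.exp (g θ) = F (torusProj θ) := fun θ => hg (Set.mem_univ θ)
  have hint : ∀ (k : Fin n → ℤ) (θ : Fin n → ℝ), ∃ N : ℤ,
      g (θ + fun i => (k i : ℝ)) = g θ + N * (2 * Real.pi * Complex.I) := by
    intro k θ
    refine Complex.exp_eq_exp_iff_exists_int.1 ?_
    rw [hg, hg, ← torusProj_eq_iff.2 ⟨k, rfl⟩]
  choose N hN using hint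
  have hc0 : (2 * Real.pi * Complex.I : ℂ) ≠ 0 := Complex.two_pi_I_ne_zero
  -- The integer `N k θ` depends continuously on `θ`, hence not at all.
  have hNconst : ∀ k θ, N k θ = N k 0 := by
    intro k θ
    have hcont : Continuous fun θ => (N k θ : ℝ) := by
      have : (fun θ => (N k θ : ℝ)) = fun θ =>
          ((g (θ + fun i => (k i : ℝ)) - g θ) / (2 * Real.pi * Complex.I)).re := by
        funext θ
        rw [hN, add_sub_cancel_left, mul_div_cancel_right₀ _ hc0, Complex.intCast_re]
      rw [this]
      fun_prop
    have hcont' : Continuous (N k) :=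
      Int.isClosedEmbedding_coe_real.isEmbedding.continuous_iff.2 hcont
    exact PreconnectedSpace.constant inferInstance hcont'
  let W : (Fin n → ℤ) →+ ℤ := AddMonoidHom.mk' (fun k => N k 0) (by
    intro k l
    have h1 := hN (k + l) 0
    have h2 := hN l (0 + fun i => (k i : ℝ))
    rw [hNconst l, hN k 0, add_assoc (0 : Fin n → ℝ)] at h2
    have h3 : ((fun i => (k i : ℝ)) + fun i => (l i : ℝ)) =
        fun i => (((k + l) i : ℤ) : ℝ) := by
      funext i
      simp
    rw [h3, h1, add_assoc, ← add_mul] at h2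
    exact_mod_cast mul_right_cancel₀ hc0 (add_left_cancel h2))
  set m : Fin n → ℤ := fun i => W (Pi.single i 1) with hm
  have hW : ∀ k, W k = ∑ i, m i * k i := by
    intro k
    conv_lhs => rw [← Finset.univ_sum_single k, map_sum]
    refine Finset.sum_congr rfl fun i _ => ?_
    have : Pi.single i (k i) = k i • (Pi.single i 1 : Fin n → ℤ) := by
      rw [← Pi.single_smul, smul_eq_mul, mul_one]
    rw [this, map_zsmul, smul_eq_mul, mul_comm]
  let ψ : (Fin n → ℝ) → ℂ := fun θ => g θ - 2 * Real.pi * Complex.I * ∑ i, (m i : ℂ) * θ i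
  have hψc : Continuous ψ := by
    refine hgc.sub (continuous_const.mul (continuous_finsetSum _ fun i _ => ?_))
    exact continuous_const.mul (Complex.continuous_ofReal.comp (continuous_apply i))
  have hψ : ∀ ⦃θ η⦄, torusProj θ = torusProj η → ψ θ = ψ η := by
    intro θ η h
    obtain ⟨k, rfl⟩ := torusProj_eq_iff.1 h
    have h1 : (N k 0 : ℂ) = ∑ i, (m i : ℂ) * k i := by
      have := hW k
      exact_mod_cast this
    simp only [ψ, hN, hNconst k θ, h1, Pi.add_apply]
    push_cast
    simp only [mul_add, Finset.sum_add_distrib]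
    ring
  refine ⟨m, hπ.lift ⟨ψ, hψc⟩ @hψ, fun x => ?_⟩
  obtain ⟨θ, rfl⟩ := hπ.surjective x
  have h1 : hπ.lift ⟨ψ, hψc⟩ @hψ (torusProj θ) = ψ θ :=
    DFunLike.congr_fun (hπ.lift_comp ⟨ψ, hψc⟩ @hψ) θ
  rw [h1, ← hg]
  change _ = UnitAddTorus.mFourier m (fun i => (θ i : UnitAddCircle)) * _
  rw [mFourier_coe, ← Complex.exp_add]
  congr 1
  simp [ψ]

/-- A continuous function on the torus is uniformly close to a trigonometric polynomial. -/
lemma exists_lift_torusHom_near (Ψ : C(UnitAddTorus (Fin n), ℂ)) {ε : ℝ} (hε : 0 < ε) :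
    ∃ g : AddMonoidAlgebra ℂ (Fin n → ℤ),
      ∀ x, ‖Ψ x - AddMonoidAlgebra.lift ℂ ℂ (Fin n → ℤ) (torusHom x) g‖ < ε := by
  have hΨ : Ψ ∈ closure (Submodule.span ℂ (Set.range (UnitAddTorus.mFourier (d := Fin n))) :
      Set C(UnitAddTorus (Fin n), ℂ)) := by
    rw [← Submodule.topologicalClosure_coe, UnitAddTorus.span_mFourier_closure_eq_top]
    trivial
  obtain ⟨G, hG, hdist⟩ := Metric.mem_closure_iff.1 hΨ ε hε
  obtain ⟨c, rfl⟩ := Finsupp.mem_span_range_iff_exists_finsupp.1 hG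
  refine ⟨AddMonoidAlgebra.ofCoeff c, fun x => ?_⟩
  refine lt_of_le_of_lt ?_ hdist
  rw [dist_eq_norm]
  refine le_trans (le_of_eq ?_) (ContinuousMap.norm_coe_le_norm _ x)
  rw [AddMonoidAlgebra.lift_apply, ContinuousMap.sub_apply]
  congr 2
  simp only [Finsupp.sum, ContinuousMap.coe_sum, Finset.sum_apply, ContinuousMap.coe_smul,
    Pi.smul_apply]
  rfl

/-- A trigonometric polynomial bounded away from zero on `ℝ^d` equals a character times the
exponential of a trigonometric polynomial, up to a factor close to one. -/
lemma exists_expChar_mul_exp_near {φ : (Fin n → ℤ) →+ EuclideanSpace ℝ (Fin d)}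
    (hφ : Function.Injective φ) (p : AddMonoidAlgebra ℂ (Fin n → ℤ)) {c : ℝ} (hc : 0 < c)
    (hp : ∀ t, c ≤ ‖trigPoly φ p t‖) :
    ∃ (m : Fin n → ℤ) (g : AddMonoidAlgebra ℂ (Fin n → ℤ)),
      ∀ t, ‖trigPoly φ p t * expChar t (-φ m) * Complex.exp (-trigPoly φ g t) - 1‖ ≤ 1 / 4 := by
  obtain ⟨m, Ψ, hΨ⟩ := exists_eq_mFourier_mul_exp (continuous_lift_torusHom p)
    fun x => lift_ne_zero_of_le_norm_trigPoly hφ p hc hp (norm_torusHom x)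
  obtain ⟨g, hg⟩ := exists_lift_torusHom_near Ψ (ε := 1 / 8) (by norm_num)
  refine ⟨m, g, fun t => ?_⟩
  obtain ⟨x, hx⟩ := exists_torusHom_eq_expCharHom φ t
  have h1 : UnitAddTorus.mFourier m x = expChar t (φ m) := DFunLike.congr_fun hx (.ofAdd m)
  have h2 := hg x
  have h3 : trigPoly φ p t * expChar t (-φ m) * Complex.exp (-trigPoly φ g t) =
      Complex.exp (Ψ x - AddMonoidAlgebra.lift ℂ ℂ (Fin n → ℤ) (torusHom x) g) := by
    have h4 : expChar t (φ m) * expChar t (-φ m) = 1 := by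
      rw [← expChar_add_right, add_neg_cancel, expChar_zero_right]
    rw [trigPoly, trigPoly, ← hx, hΨ x, h1, sub_eq_add_neg, Complex.exp_add]
    linear_combination Complex.exp (Ψ x) *
      Complex.exp (-AddMonoidAlgebra.lift ℂ ℂ (Fin n → ℤ) (torusHom x) g) * h4
  rw [h3]
  refine (Complex.norm_exp_sub_one_le (h2.le.trans (by norm_num))).trans ?_
  linarith

end Torus

/-! ### Exponential representation of functions bounded away from zero -/

section ExponentialRepresentation

variable {d : ℕ}

/-- A trigonometric polynomial with frequencies in `H` only involves a finitely generated subgroup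
of `H`, which is free, so it can be rewritten with independent frequencies. -/
lemma exists_trigPoly_eq_of_free (H : AddSubgroup (EuclideanSpace ℝ (Fin d)))
    (p : AddMonoidAlgebra ℂ H) :
    ∃ (n : ℕ) (φ : (Fin n → ℤ) →+ EuclideanSpace ℝ (Fin d)) (p' : AddMonoidAlgebra ℂ (Fin n → ℤ)),
      Function.Injective φ ∧ (∀ m, φ m ∈ H) ∧ ∀ t, trigPoly H.subtype p t = trigPoly φ p' t := by
  set K : AddSubgroup H := AddSubgroup.closure (p.coeff.support : Set H) with hK
  have hfin : Module.Finite ℤ K := by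
    have := p.coeff.support.finite_toSet.to_subtype
    exact AddMonoid.FG.to_moduleFinite_int
  have htf : IsAddTorsionFree (EuclideanSpace ℝ (Fin d)) :=
    .of_isTorsionFree ℝ _
  have hinj : Function.Injective fun u : K => ((u : H) : EuclideanSpace ℝ (Fin d)) :=
    Subtype.val_injective.comp Subtype.val_injective
  have htfK : Module.IsTorsionFree ℤ K :=
    hinj.moduleIsTorsionFree _ fun _ _ => rfl
  let b := Module.finBasis ℤ K
  let φ : (Fin (Module.finrank ℤ K) → ℤ) →+ EuclideanSpace ℝ (Fin d) :=
    H.subtype.comp (K.subtype.comp b.equivFun.symm.toLinearMap.toAddMonoidHom)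
  refine ⟨_, φ, ∑ u ∈ p.coeff.support.attach, AddMonoidAlgebra.single
    (b.equivFun ⟨u, AddSubgroup.subset_closure u.2⟩) (p.coeff u),
    hinj.comp b.equivFun.symm.injective, fun m => Subtype.prop _, fun t => ?_⟩
  rw [trigPoly_eq_sum, trigPoly, map_sum, ← Finset.sum_attach]
  refine Finset.sum_congr rfl fun u _ => ?_
  rw [AddMonoidAlgebra.lift_single, smul_eq_mul]
  congr 1
  change expChar t _ = expChar t (b.equivFun.symm (b.equivFun _) : K)
  rw [LinearEquiv.symm_apply_apply]
  rfl

/-- The Wiener–Lévy theorem for absolutely convergent almost periodic series: a function bounded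
away from zero with an absolutely convergent expansion is a character times the exponential of such
a function. Up to a small relative error it is a trigonometric polynomial, whose logarithm is found
on the torus, and the error has a logarithm by `HasAbsExpansion.exists_log`. -/
lemma HasAbsExpansion.exists_eq_expChar_mul_exp {H : AddSubgroup (EuclideanSpace ℝ (Fin d))}
    {f : EuclideanSpace ℝ (Fin d) → ℂ} {C : ℝ} (hf : HasAbsExpansion H f C) {c : ℝ} (hc : 0 < c)
    (hfc : ∀ t, c ≤ ‖f t‖) :
    ∃ γ ∈ H, ∃ (a : EuclideanSpace ℝ (Fin d) → ℂ) (D : ℝ), HasAbsExpansion H a D ∧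
      ∀ t, f t = expChar t γ * Complex.exp (a t) := by
  -- The relative error is at most `(c / 4) / (3 * c / 4) = 1 / 3`, which leaves room for the error
  -- `1 / 4` on the torus: `1 / 4 + (1 / 3) * (5 / 4) = 2 / 3 < 1`.
  obtain ⟨p₀, hp₀⟩ := hf.exists_trigPoly_sub (ε := c / 4) (by linarith)
  obtain ⟨n, φ, p, hφ, hφH, hpp⟩ := exists_trigPoly_eq_of_free H p₀
  simp only [hpp] at hp₀
  have hp : ∀ t, 3 * c / 4 ≤ ‖trigPoly φ p t‖ := by
    intro t
    have h1 := hp₀.norm_le t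
    have h2 := norm_sub_norm_le (f t) (f t - trigPoly φ p t)
    rw [sub_sub_cancel] at h2
    linarith [hfc t]
  obtain ⟨m, g, hg⟩ := exists_expChar_mul_exp_near hφ p (by linarith : 0 < 3 * c / 4) hp
  have hG : HasAbsExpansion H (trigPoly φ g) (coeffNorm g) := .of_trigPoly hφH g
  have hF := (hf.mul (.const_mul_expChar 1 (H.neg_mem (hφH m)))).mul hG.neg.exp
  obtain ⟨a, D, ha, hFa⟩ := hF.exists_log (ρ := 2 / 3) (by norm_num) (by
    intro t
    set X := expChar t (-φ m) * Complex.exp (-trigPoly φ g t) with hX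
    have h1 : ‖trigPoly φ p t * X - 1‖ ≤ 1 / 4 := by rw [hX, ← mul_assoc]; exact hg t
    have h2 : ‖trigPoly φ p t * X‖ ≤ 5 / 4 := by
      have := norm_sub_norm_le (trigPoly φ p t * X) 1
      rw [norm_one] at this
      linarith
    have h3 : c * ‖X‖ ≤ 5 / 3 := by
      rw [norm_mul] at h2
      nlinarith [hp t, norm_nonneg X]
    have h4 : ‖(f t - trigPoly φ p t) * X‖ ≤ 5 / 12 := by
      rw [norm_mul]
      nlinarith [hp₀.norm_le t, norm_nonneg X]
    calc ‖f t * (1 * expChar t (-φ m)) * Complex.exp (-trigPoly φ g t) - 1‖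
        = ‖(f t - trigPoly φ p t) * X + (trigPoly φ p t * X - 1)‖ := by rw [hX]; ring_nf
      _ ≤ 5 / 12 + 1 / 4 := (norm_add_le _ _).trans (add_le_add h4 h1)
      _ = 2 / 3 := by norm_num)
  refine ⟨φ m, hφH m, fun t => trigPoly φ g t + a t, _, hG.add ha, fun t => ?_⟩
  have h1 : expChar t (φ m) * expChar t (-φ m) = 1 := by
    rw [← expChar_add_right, add_neg_cancel, expChar_zero_right]
  have h2 : Complex.exp (trigPoly φ g t) * Complex.exp (-trigPoly φ g t) = 1 := by
    rw [← Complex.exp_add, add_neg_cancel, Complex.exp_zero]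
  rw [Complex.exp_add, ← hFa t]
  linear_combination (-f t * Complex.exp (trigPoly φ g t) * Complex.exp (-trigPoly φ g t)) * h1
    - f t * h2

end ExponentialRepresentation

/-! ### The group of coordinatewise integer combinations -/

section CoordSpan

variable {d : ℕ} (Y : Set (EuclideanSpace ℝ (Fin d)))

/-- `coordSpan Y` as an additive subgroup of `ℝ^d`. -/
def coordSpanSubgroup : AddSubgroup (EuclideanSpace ℝ (Fin d)) where
  carrier := coordSpan Y
  zero_mem' _ := zero_mem _
  add_mem' hu hv j := add_mem (hu j) (hv j)
  neg_mem' hu j := neg_mem (hu j)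

lemma subset_coordSpan : Y ⊆ coordSpan Y :=
  fun y hy _ => AddSubgroup.subset_closure ⟨y, hy, rfl⟩

variable {Y}

lemma countable_addSubgroupClosure {A : Type*} [AddCommGroup A] {s : Set A} (hs : s.Countable) :
    (AddSubgroup.closure s : Set A).Countable := by
  have := hs.to_subtype
  have hc : Countable (Submodule.span ℤ (Set.range ((↑) : s → A))) := inferInstance
  rw [Subtype.range_coe] at hc
  rw [← Submodule.span_int_eq_addSubgroupClosure]
  exact Set.countable_coe_iff.1 hc

lemma countable_coordSpan (hY : Y.Countable) : (coordSpan Y).Countable := by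
  have h : (Set.univ.pi fun j => (AddSubgroup.closure
      ((fun y : EuclideanSpace ℝ (Fin d) => y j) '' Y) : Set ℝ)).Countable :=
    Set.countable_univ_pi fun j => countable_addSubgroupClosure (hY.image _)
  have hp := h.preimage (f := fun (u : EuclideanSpace ℝ (Fin d)) j => u j)
    fun u v h => PiLp.ext fun j => congrFun h j
  refine hp.mono fun u hu => ?_
  exact fun j _ => hu j

lemma hasAbsExpansion_tsum_coordSpan {f : EuclideanSpace ℝ (Fin d) → ℂ}
    {q : EuclideanSpace ℝ (Fin d) → ℂ} (hq : Summable fun y : Y => ‖q y‖)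
    (hf : ∀ t, f t = ∑' y : Y, q y * expChar t y) :
    HasAbsExpansion (coordSpanSubgroup Y) f (∑' y : Y, ‖q y‖) :=
  ⟨Y, fun y => q y, fun y => y, fun y => subset_coordSpan Y y.2, hq, le_rfl, hf⟩

lemma tsum_coordSpan_diff
    {F : EuclideanSpace ℝ (Fin d) → ℂ} (hF : F 0 = 0) :
    ∑' u : coordSpanSubgroup Y, F u = ∑' u : ↥(coordSpan Y \ {0}), F u := by
  change ∑' u : ↥(coordSpan Y), F u = _
  rw [tsum_subtype (coordSpan Y) F, tsum_subtype (coordSpan Y \ {0}) F]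
  refine tsum_congr fun u => ?_
  by_cases hu : u = 0
  · subst hu
    simp [hF]
  · by_cases hc : u ∈ coordSpan Y <;> simp [hu, hc]

/-- The exponent in the representation with Lévy measure `∑ l_u δ_u`. -/
lemma hasAbsExpansion_levyExponent {l : EuclideanSpace ℝ (Fin d) → ℂ}
    (hl : Summable fun u : ↥(coordSpan Y \ {0}) => ‖l u‖) :
    HasAbsExpansion (coordSpanSubgroup Y)
      (fun t => ∑' u : ↥(coordSpan Y \ {0}), l u * (expChar t u - 1))
      (∑' u : ↥(coordSpan Y \ {0}), ‖l u‖ + ‖∑' u : ↥(coordSpan Y \ {0}), l u‖) := by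
  have h1 : HasAbsExpansion (coordSpanSubgroup Y)
      (fun t => ∑' u : ↥(coordSpan Y \ {0}), l u * expChar t u)
      (∑' u : ↥(coordSpan Y \ {0}), ‖l u‖) :=
    ⟨↥(coordSpan Y \ {0}), fun u => l u, fun u => u, fun u => u.2.1, hl, le_rfl, fun _ => rfl⟩
  refine (h1.sub (.const _ (∑' u : ↥(coordSpan Y \ {0}), l u))).congr fun t => ?_
  rw [← (summable_norm_mul_expChar hl _ t).of_norm.tsum_sub hl.of_norm]
  simp only [mul_sub, mul_one]

/-- The Wiener–Lévy representation, normalized at the origin. -/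
lemma exists_levyExponent {h q : EuclideanSpace ℝ (Fin d) → ℂ}
    (hq : Summable fun y : Y => ‖q y‖) (hh : ∀ t, h t = ∑' y : Y, q y * expChar t y)
    (h0 : h 0 = 1) {c : ℝ} (hc : 0 < c) (hhc : ∀ t, c ≤ ‖h t‖) :
    ∃ γ ∈ coordSpan Y, ∃ l : EuclideanSpace ℝ (Fin d) → ℂ,
      (Summable fun u : ↥(coordSpan Y \ {0}) => ‖l u‖) ∧
      ∀ t, h t = Complex.exp (Complex.I * ((inner ℝ t γ : ℝ) : ℂ) +
        ∑' u : ↥(coordSpan Y \ {0}), l u * (expChar t u - 1)) := by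
  obtain ⟨γ, hγ, a, D, ha, hha⟩ :=
    (hasAbsExpansion_tsum_coordSpan hq hh).exists_eq_expChar_mul_exp hc hhc
  obtain ⟨l, hl, hal⟩ := ha.exists_coeff
  refine ⟨γ, hγ, l, ?_, fun t => ?_⟩
  · exact hl.comp_injective (i := fun u : ↥(coordSpan Y \ {0}) =>
      (⟨u, u.2.1⟩ : coordSpanSubgroup Y)) fun u v huv => Subtype.ext (congrArg (·.1) huv)
  · have h1 : Complex.exp (a 0) = 1 := by
      rw [← h0, hha 0, expChar_zero_left, one_mul]
    rw [← tsum_coordSpan_diff (F := fun u => l u * (expChar t u - 1)) (by simp)]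
    have h2 : ∑' u : coordSpanSubgroup Y, l u * (expChar t u - 1) = a t - a 0 := by
      rw [hal t, hal 0, ← (summable_norm_mul_expChar hl _ t).of_norm.tsum_sub
        (summable_norm_mul_expChar hl _ 0).of_norm]
      simp only [mul_sub, mul_one, expChar_zero_left]
    rw [h2, Complex.exp_add, Complex.exp_sub, h1, div_one, hha]
    rfl

/-- The reciprocal of an exponential representation has an absolutely convergent expansion. -/
lemma exists_reciprocal_expansion {h l : EuclideanSpace ℝ (Fin d) → ℂ}
    {γ : EuclideanSpace ℝ (Fin d)} (hγ : γ ∈ coordSpan Y)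
    (hl : Summable fun u : ↥(coordSpan Y \ {0}) => ‖l u‖)
    (hh : ∀ t, h t = Complex.exp (Complex.I * ((inner ℝ t γ : ℝ) : ℂ) +
        ∑' u : ↥(coordSpan Y \ {0}), l u * (expChar t u - 1))) :
    ∃ r : EuclideanSpace ℝ (Fin d) → ℂ, (Summable fun z : coordSpan Y => ‖r z‖) ∧
      ∀ t, 1 / h t = ∑' z : coordSpan Y, r z * expChar t z := by
  have hH : HasAbsExpansion (coordSpanSubgroup Y) _ _ :=
    (HasAbsExpansion.const_mul_expChar 1 ((coordSpanSubgroup Y).neg_mem hγ)).mul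
      (hasAbsExpansion_levyExponent hl).neg.exp
  refine (hH.congr (g := fun t => 1 / h t) fun t => ?_).exists_coeff
  have h1 : expChar t (-γ) = Complex.exp (-(Complex.I * ((inner ℝ t γ : ℝ) : ℂ))) := by
    rw [expChar, inner_neg_right]
    push_cast
    rw [mul_neg]
  rw [hh, one_div, ← Complex.exp_neg, one_mul, h1, ← Complex.exp_add, neg_add]

end CoordSpan

/-! ### Lévy–Khintchine exponents bound almost periodic functions from below -/

section LowerBound

variable {d : ℕ}

/-- A nonzero absolutely convergent expansion cannot be uniformly small on any translate of a
suitable finite set: averaging along a progression isolates the coefficient at `y₀`, with an error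
that does not depend on the translate. -/
lemma exists_finset_translates_lower_bound {Y : Set (EuclideanSpace ℝ (Fin d))}
    {q h : EuclideanSpace ℝ (Fin d) → ℂ} (hq : Summable fun y : Y => ‖q y‖)
    (hh : ∀ t, h t = ∑' y : Y, q y * expChar t y) {y₀ : EuclideanSpace ℝ (Fin d)} (hy₀ : y₀ ∈ Y)
    (hqy : q y₀ ≠ 0) :
    ∃ (S : Finset (EuclideanSpace ℝ (Fin d))) (δ : ℝ), 0 < δ ∧
      ∀ t, ∃ s ∈ S, δ ≤ ‖h (t + s)‖ := by
  classical
  set z₀ : Y := ⟨y₀, hy₀⟩ with hz₀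
  set β : ℝ := ‖q y₀‖ / 4 with hβ
  have hβ0 : 0 < β := by have := norm_pos_iff.2 hqy; positivity
  obtain ⟨F, hFtail, hzF⟩ := (((tendsto_order.1
    (tendsto_tsum_compl_atTop_zero fun y : Y => ‖q y‖)).2 β hβ0).and
      (eventually_ge_atTop {z₀})).exists
  replace hzF : z₀ ∈ F := hzF (Finset.mem_singleton_self _)
  set P : EuclideanSpace ℝ (Fin d) → ℂ := fun t => ∑ y ∈ F, q y * expChar t y with hP
  have hhP : ∀ t, ‖h t - P t‖ ≤ β := by
    intro t
    rw [hh, ← (summable_norm_mul_expChar hq (fun y : Y => (y : EuclideanSpace ℝ (Fin d)))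
      t).of_norm.sum_add_tsum_subtype_compl F, add_sub_cancel_left]
    have hs := (summable_norm_mul_expChar hq (fun y : Y => (y : EuclideanSpace ℝ (Fin d)))
      t).subtype {y | y ∉ F}
    refine (norm_tsum_le_tsum_norm hs).trans (le_of_eq_of_le ?_ hFtail.le)
    exact tsum_congr fun y => by rw [norm_mul, norm_expChar, mul_one]
  obtain ⟨s, hs⟩ := exists_tendsto_average
    ((F.erase z₀).image fun y : Y => (y : EuclideanSpace ℝ (Fin d)) - y₀) (by
    intro h0
    obtain ⟨y, hy, hy0⟩ := Finset.mem_image.1 h0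
    exact (Finset.mem_erase.1 hy).1 (Subtype.ext (sub_eq_zero.1 hy0)))
  set A : ℕ → Y → ℂ := fun N y =>
    (N : ℂ)⁻¹ * ∑ k ∈ Finset.range N, expChar (k • s) ((y : EuclideanSpace ℝ (Fin d)) - y₀) with hA
  have hlim : Tendsto (fun N => ∑ y ∈ F.erase z₀, ‖q y‖ * ‖A N y‖) atTop (𝓝 0) := by
    have : Tendsto (fun N => ∑ y ∈ F.erase z₀, ‖q y‖ * ‖A N y‖) atTop
        (𝓝 (∑ y ∈ F.erase z₀, ‖q y‖ * ‖(0 : ℂ)‖)) :=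
      tendsto_finsetSum _ fun y hy =>
        (hs _ (Finset.mem_image_of_mem _ hy)).norm.const_mul _
    simpa using this
  obtain ⟨N, hN, hN0⟩ := (((tendsto_order.1 hlim).2 β hβ0).and (eventually_gt_atTop 0)).exists
  refine ⟨(Finset.range N).image fun k => k • s, β, hβ0, fun t => ?_⟩
  by_contra! hsmall
  -- The average of `P · e^{-i⟨·, y₀⟩}` would be at most `2β`, yet it is within `β` of `q y₀`, where
  -- `‖q y₀‖ = 4β`.
  have hNC : (N : ℂ) ≠ 0 := by exact_mod_cast hN0.ne'
  have hPs : ∀ k ∈ Finset.range N, ‖P (t + k • s) * expChar (t + k • s) (-y₀)‖ ≤ 2 * β := by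
    intro k hk
    rw [norm_mul, norm_expChar, mul_one]
    have h1 := (hsmall _ (Finset.mem_image_of_mem _ hk)).le
    have h2 := hhP (t + k • s)
    have h3 := norm_sub_le (h (t + k • s)) (h (t + k • s) - P (t + k • s))
    rw [sub_sub_cancel] at h3
    linarith
  have havg : (N : ℂ)⁻¹ * ∑ k ∈ Finset.range N, P (t + k • s) * expChar (t + k • s) (-y₀) =
      q y₀ + ∑ y ∈ F.erase z₀, q y * expChar t ((y : EuclideanSpace ℝ (Fin d)) - y₀) * A N y := by
    have h1 : ∀ k : ℕ, P (t + k • s) * expChar (t + k • s) (-y₀) = ∑ y ∈ F,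
        q y * expChar t ((y : EuclideanSpace ℝ (Fin d)) - y₀) *
          expChar (k • s) ((y : EuclideanSpace ℝ (Fin d)) - y₀) := by
      intro k
      rw [hP, Finset.sum_mul]
      refine Finset.sum_congr rfl fun y _ => ?_
      rw [mul_assoc, ← expChar_add_right, ← sub_eq_add_neg, expChar_add_left, mul_assoc]
    have h2 : (N : ℂ)⁻¹ * ∑ k ∈ Finset.range N, P (t + k • s) * expChar (t + k • s) (-y₀) =
        ∑ y ∈ F, q y * expChar t ((y : EuclideanSpace ℝ (Fin d)) - y₀) * A N y := by
      simp only [h1, hA]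
      rw [Finset.sum_comm, Finset.mul_sum]
      refine Finset.sum_congr rfl fun y _ => ?_
      rw [← Finset.mul_sum]
      ring
    rw [h2, ← Finset.add_sum_erase F _ hzF]
    congr 1
    simp [hA, hz₀, hNC]
  have hupper : ‖(N : ℂ)⁻¹ * ∑ k ∈ Finset.range N, P (t + k • s) * expChar (t + k • s) (-y₀)‖ ≤
      2 * β := by
    rw [norm_mul, norm_inv, Complex.norm_natCast, inv_mul_le_iff₀ (by exact_mod_cast hN0)]
    refine (norm_sum_le_of_le _ hPs).trans (by simp)
  have herr : ‖∑ y ∈ F.erase z₀, q y * expChar t ((y : EuclideanSpace ℝ (Fin d)) - y₀) * A N y‖ ≤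
      ∑ y ∈ F.erase z₀, ‖q y‖ * ‖A N y‖ :=
    norm_sum_le_of_le _ fun y _ => by rw [norm_mul, norm_mul, norm_expChar, mul_one]
  rw [havg] at hupper
  have h5 := norm_sub_le (q y₀ + ∑ y ∈ F.erase z₀,
    q y * expChar t ((y : EuclideanSpace ℝ (Fin d)) - y₀) * A N y) (∑ y ∈ F.erase z₀,
    q y * expChar t ((y : EuclideanSpace ℝ (Fin d)) - y₀) * A N y)
  rw [add_sub_cancel_right] at h5
  linarith

/-- The second difference of the Lévy–Khintchine integrand is bounded uniformly in `t`. -/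
lemma norm_secondDifference_levyIntegrand_le (t s u : EuclideanSpace ℝ (Fin d)) :
    ‖levyIntegrand t u - levyIntegrand (t + s) u + (levyIntegrand t u - levyIntegrand (t - s) u)‖ ≤
      (4 + ‖s‖ ^ 2) * min (‖u‖ ^ 2) 1 := by
  have h1 : levyIntegrand t u - levyIntegrand (t + s) u +
      (levyIntegrand t u - levyIntegrand (t - s) u) =
      expChar t u * ((expChar s u - 1) * (starRingEnd ℂ) (expChar s u - 1)) := by
    have h2 : expChar s u * (starRingEnd ℂ) (expChar s u) = 1 := by
      rw [Complex.mul_conj, Complex.normSq_eq_norm_sq, norm_expChar]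
      norm_num
    rw [map_sub, map_one]
    simp only [levyIntegrand, sub_eq_add_neg t s, expChar_add_left, expChar_neg_left,
      inner_add_left, inner_neg_left]
    push_cast
    linear_combination (-expChar t u) * h2
  rw [h1, norm_mul, norm_expChar, one_mul, norm_mul, RCLike.norm_conj, ← sq]
  have h3 : ‖expChar s u - 1‖ ≤ 2 := by
    calc ‖expChar s u - 1‖ ≤ ‖expChar s u‖ + ‖(1 : ℂ)‖ := norm_sub_le _ _
      _ = 2 := by rw [norm_expChar, norm_one]; norm_num
  have h4 : ‖expChar s u - 1‖ ≤ ‖s‖ * ‖u‖ :=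
    Real.norm_exp_I_mul_ofReal_sub_one_le.trans (norm_inner_le_norm s u)
  have h5 : ‖expChar s u - 1‖ ^ 2 ≤ 4 := by nlinarith [norm_nonneg (expChar s u - 1)]
  have h6 : ‖expChar s u - 1‖ ^ 2 ≤ ‖s‖ ^ 2 * ‖u‖ ^ 2 := by
    rw [← mul_pow]
    exact pow_le_pow_left₀ (norm_nonneg _) h4 2
  rcases min_cases (‖u‖ ^ 2) 1 with ⟨h, -⟩ | ⟨h, -⟩ <;> rw [h] <;>
    nlinarith [sq_nonneg ‖s‖, sq_nonneg ‖u‖]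

namespace ComplexLevyMeasure

/-- The second differences of a Lévy–Khintchine integral in direction `s` are bounded uniformly
in the base point `t`. -/
lemma norm_secondDifference_le (ν : ComplexLevyMeasure d) {Ψ : EuclideanSpace ℝ (Fin d) → ℂ}
    (hΨ : ∀ t, ν.HasIntegral (levyIntegrand t) (Ψ t))
    (hν : ∫⁻ x, ENNReal.ofReal (min (‖x‖ ^ 2) 1) ∂ν.totalVariation < ∞)
    (t s : EuclideanSpace ℝ (Fin d)) :
    ‖Ψ t - Ψ (t + s) + (Ψ t - Ψ (t - s))‖ ≤
      (4 + ‖s‖ ^ 2) * (∫⁻ x, ENNReal.ofReal (min (‖x‖ ^ 2) 1) ∂ν.totalVariation).toReal := by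
  set I := ∫⁻ x, ENNReal.ofReal (min (‖x‖ ^ 2) 1) ∂ν.totalVariation with hI
  have hlim := (((hΨ t).2.sub (hΨ (t + s)).2).add ((hΨ t).2.sub (hΨ (t - s)).2)).norm
  refine le_of_tendsto hlim ?_
  filter_upwards [self_mem_nhdsWithin] with r hr
  have hle : (ν.trunc r).variation ≤ ν.totalVariation :=
    le_iSup (fun r : Set.Ioi (0 : ℝ) => (ν.trunc r).variation) ⟨r, hr⟩
  have hint : ∀ t, (ν.trunc r).Integrable (levyIntegrand t) := fun t => (hΨ t).1.mono_measure hle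
  rw [← VectorMeasure.integral_fun_sub (hint t) (hint (t + s)),
    ← VectorMeasure.integral_fun_sub (hint t) (hint (t - s)),
    ← VectorMeasure.integral_fun_add ((hint t).fun_sub (hint _)) ((hint t).fun_sub (hint _)),
    ← ENNReal.ofReal_le_ofReal_iff (by positivity), ofReal_norm,
    ENNReal.ofReal_mul (by positivity), ENNReal.ofReal_toReal hν.ne]
  refine VectorMeasure.enorm_integral_le_lintegral_enorm.trans ?_
  have hB : ‖ContinuousLinearMap.mul ℝ ℂ‖ₑ ≤ 1 := by
    rw [← ofReal_norm, ENNReal.ofReal_le_one]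
    exact ContinuousLinearMap.opNorm_mul_le ℝ ℂ
  refine (mul_le_of_le_one_left zero_le hB).trans ((lintegral_mono' hle (g := fun u =>
    ENNReal.ofReal (4 + ‖s‖ ^ 2) * ENNReal.ofReal (min (‖u‖ ^ 2) 1)) ?_).trans ?_)
  · intro u
    beta_reduce
    rw [← ENNReal.ofReal_mul (by positivity), ← ofReal_norm]
    exact ENNReal.ofReal_le_ofReal (norm_secondDifference_levyIntegrand_le t s u)
  · rw [lintegral_const_mul' _ _ ENNReal.ofReal_ne_top]

end ComplexLevyMeasure

/-- A function with an absolutely convergent expansion and a Lévy–Khintchine exponent is bounded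
away from zero. The second difference bound gives `|h(t+s)|² ≤ K(s) |h(t)| |h(t+2s)|`, and some
`s` in a fixed finite set makes the left side large. -/
lemma exists_lower_bound_of_levyKhintchine {Y : Set (EuclideanSpace ℝ (Fin d))}
    {q h : EuclideanSpace ℝ (Fin d) → ℂ} (hq : Summable fun y : Y => ‖q y‖)
    (hh : ∀ t, h t = ∑' y : Y, q y * expChar t y) (hq0 : 0 < ∑' y : Y, ‖q y‖)
    {γ : Fin d → ℂ} {Q : Matrix (Fin d) (Fin d) ℂ} {ν : ComplexLevyMeasure d}
    (hν : ∫⁻ x, ENNReal.ofReal (min (‖x‖ ^ 2) 1) ∂ν.totalVariation < ∞)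
    {Ψ : EuclideanSpace ℝ (Fin d) → ℂ} (hΨ : ∀ t, ν.HasIntegral (levyIntegrand t) (Ψ t))
    (hhΨ : ∀ t, h t = Complex.exp (Complex.I * (toComplexVec t ⬝ᵥ γ)
      - 1 / 2 * (toComplexVec t ⬝ᵥ (Q *ᵥ toComplexVec t)) + Ψ t)) :
    ∃ c, 0 < c ∧ ∀ t, c ≤ ‖h t‖ := by
  have hex : ∃ y : Y, ‖q y‖ ≠ 0 := by
    by_contra! hall
    simp [hall] at hq0
  obtain ⟨⟨y₀, hy₀⟩, hqy⟩ := hex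
  obtain ⟨S, δ, hδ, hS⟩ :=
    exists_finset_translates_lower_bound hq hh hy₀ (norm_ne_zero_iff.1 hqy)
  set M := ∑' y : Y, ‖q y‖ with hM
  have hhM : ∀ t, ‖h t‖ ≤ M := (hasAbsExpansion_tsum_coordSpan hq hh).norm_le
  set I := (∫⁻ x, ENNReal.ofReal (min (‖x‖ ^ 2) 1) ∂ν.totalVariation).toReal with hI
  let κ : EuclideanSpace ℝ (Fin d) → ℝ := fun s => Real.exp
    (‖toComplexVec s ⬝ᵥ (Q *ᵥ toComplexVec s)‖ + (4 + ‖s‖ ^ 2) * I)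
  have hvadd : ∀ t s : EuclideanSpace ℝ (Fin d),
      toComplexVec (t + s) = toComplexVec t + toComplexVec s := by
    intro t s
    funext j
    simp [toComplexVec]
  have hvsub : ∀ t s : EuclideanSpace ℝ (Fin d),
      toComplexVec (t - s) = toComplexVec t - toComplexVec s := by
    intro t s
    funext j
    simp [toComplexVec]
  have hkey : ∀ t s, ‖h t‖ ^ 2 ≤ ‖h (t + s)‖ * ‖h (t - s)‖ * κ s := by
    intro t s
    have h1 : h t ^ 2 = h (t + s) * h (t - s) * Complex.exp
        (toComplexVec s ⬝ᵥ (Q *ᵥ toComplexVec s) + (Ψ t - Ψ (t + s) + (Ψ t - Ψ (t - s)))) := by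
      rw [hhΨ, hhΨ, hhΨ, sq, ← Complex.exp_add, ← Complex.exp_add, ← Complex.exp_add, hvadd, hvsub]
      congr 1
      simp only [Matrix.mulVec_add, Matrix.mulVec_sub, add_dotProduct, sub_dotProduct,
        dotProduct_add, dotProduct_sub]
      ring
    rw [← norm_pow, h1, norm_mul, norm_mul]
    refine mul_le_mul_of_nonneg_left ?_ (by positivity)
    rw [Complex.norm_exp]
    refine Real.exp_le_exp.2 ((Complex.re_le_norm _).trans ((norm_add_le _ _).trans ?_))
    gcongr
    exact ν.norm_secondDifference_le hΨ hν t s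
  have hκS : ∀ s ∈ S, κ s ≤ 1 + ∑ s ∈ S, κ s := fun s hs =>
    (Finset.single_le_sum (f := κ) (fun _ _ => (Real.exp_pos _).le) hs).trans (by linarith)
  set K := 1 + ∑ s ∈ S, κ s with hK
  have hK0 : 0 < K := by
    have : 0 ≤ ∑ s ∈ S, κ s := Finset.sum_nonneg fun _ _ => (Real.exp_pos _).le
    linarith
  refine ⟨δ ^ 2 / (M * K), by positivity, fun t => ?_⟩
  obtain ⟨s, hs, hδs⟩ := hS t
  rw [div_le_iff₀ (by positivity)]
  calc δ ^ 2 ≤ ‖h (t + s)‖ ^ 2 := pow_le_pow_left₀ hδ.le hδs 2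
    _ ≤ ‖h (t + s + s)‖ * ‖h (t + s - s)‖ * κ s := hkey _ _
    _ ≤ M * ‖h t‖ * K := by
      rw [add_sub_cancel_right]
      gcongr
      exacts [hhM _, hκS s hs]
    _ = ‖h t‖ * (M * K) := by ring

end LowerBound

/-! ### Summable atomic Lévy measures -/

section AtomicMeasure

variable {d : ℕ} {S : Set (EuclideanSpace ℝ (Fin d))} {a : EuclideanSpace ℝ (Fin d) → ℂ}

/-- The finite complex measure `∑_{u ∈ S} a_u δ_u`, for countable `S` and summable `a` on `S`;
it is zero if `a` is not summable. -/
noncomputable def atomicMeasure (S : Set (EuclideanSpace ℝ (Fin d)))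
    (a : EuclideanSpace ℝ (Fin d) → ℂ) : ComplexMeasure (EuclideanSpace ℝ (Fin d)) :=
  ((Measure.count : Measure S).withDensityᵥ fun u => a u).map Subtype.val

lemma isFiniteMeasure_variation_countDensity (ha : Summable fun u : S => ‖a u‖) :
    IsFiniteMeasure ((Measure.count : Measure S).withDensityᵥ fun u => a u).variation := by
  have hint : Integrable (fun u : S => a u) Measure.count := integrable_count_iff.2 ha
  rw [Measure.variation_withDensityᵥ hint]
  refine ⟨?_⟩
  rw [withDensity_apply _ MeasurableSet.univ, Measure.restrict_univ]
  exact hint.2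

lemma isFiniteMeasure_variation_atomicMeasure (ha : Summable fun u : S => ‖a u‖) :
    IsFiniteMeasure (atomicMeasure S a).variation := by
  have := isFiniteMeasure_variation_countDensity ha
  exact isFiniteMeasure_of_le _ VectorMeasure.variation_map_le

lemma integral_atomicMeasure (hS : S.Countable) (ha : Summable fun u : S => ‖a u‖)
    {f : EuclideanSpace ℝ (Fin d) → ℂ} (hf : Measurable f) {C : ℝ} (hC : ∀ u, ‖f u‖ ≤ C) :
    VectorMeasure.integral (atomicMeasure S a) f (ContinuousLinearMap.mul ℝ ℂ) =
      ∑' u : S, a u * f u := by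
  have := hS.to_subtype
  have := isFiniteMeasure_variation_countDensity ha
  have hint : Integrable (fun u : S => a u) Measure.count := integrable_count_iff.2 ha
  set m := (Measure.count : Measure S).withDensityᵥ fun u => a u with hm
  have hfm : m.Integrable (f ∘ Subtype.val) :=
    Integrable.of_bound (hf.comp measurable_subtype_coe).aestronglyMeasurable C
      (Eventually.of_forall fun u => hC _)
  rw [atomicMeasure, VectorMeasure.integral_map measurable_subtype_coe
    hf.aestronglyMeasurable hfm]
  have huniv : (⋃ u : S, ({u} : Set S)) = Set.univ := Set.iUnion_of_singleton S
  have h1 := VectorMeasure.integral_iUnion (B := ContinuousLinearMap.mul ℝ ℂ) (μ := m)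
    (f := f ∘ Subtype.val) (s := fun u : S => {u}) (fun u => measurableSet_singleton u)
    (fun u v huv => Set.disjoint_singleton.2 huv) (VectorMeasure.Integrable.integrableOn hfm)
  rw [huniv, VectorMeasure.setIntegral_univ] at h1
  refine h1.trans (tsum_congr fun u => ?_)
  rw [VectorMeasure.integral_singleton, hm, withDensityᵥ_apply hint (measurableSet_singleton u)]
  simp [mul_comm]

/-- The complex Lévy measure whose restrictions are those of a finite complex measure. -/
noncomputable def ComplexLevyMeasure.ofComplexMeasure
    (m : ComplexMeasure (EuclideanSpace ℝ (Fin d))) : ComplexLevyMeasure d where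
  trunc r := m.restrict {x | r ≤ ‖x‖}
  trunc_apply r s _ hrs B hB := by
    have hs := ComplexLevyMeasure.measurableSet_away (d := d) s
    have hr := ComplexLevyMeasure.measurableSet_away (d := d) r
    have hsub : {x : EuclideanSpace ℝ (Fin d) | s ≤ ‖x‖} ⊆ {x | r ≤ ‖x‖} :=
      fun x hx => hrs.trans hx
    rw [VectorMeasure.restrict_apply _ hs hB, VectorMeasure.restrict_apply _ hr (hB.inter hs),
      Set.inter_assoc, Set.inter_eq_left.2 hsub]

lemma ComplexLevyMeasure.totalVariation_ofComplexMeasure_le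
    (m : ComplexMeasure (EuclideanSpace ℝ (Fin d))) :
    (ComplexLevyMeasure.ofComplexMeasure m).totalVariation ≤ m.variation :=
  iSup_le fun _ => VectorMeasure.variation_restrict_le.trans Measure.restrict_le_self

/-- Bounded functions vanishing at the origin are integrable for a finite measure, seen as a Lévy
measure, with the same integral; the value at the origin matters because the restrictions to
`{x | r ≤ ‖x‖}` never see an atom there. -/
lemma ComplexLevyMeasure.hasIntegral_ofComplexMeasure
    (m : ComplexMeasure (EuclideanSpace ℝ (Fin d))) [IsFiniteMeasure m.variation]
    {f : EuclideanSpace ℝ (Fin d) → ℂ} (hf : Measurable f) {C : ℝ} (hC : ∀ u, ‖f u‖ ≤ C)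
    (hf0 : f 0 = 0) :
    (ComplexLevyMeasure.ofComplexMeasure m).HasIntegral f
      (VectorMeasure.integral m f (ContinuousLinearMap.mul ℝ ℂ)) := by
  have hle := ComplexLevyMeasure.totalVariation_ofComplexMeasure_le m
  refine ⟨?_, ?_⟩
  · have := isFiniteMeasure_of_le _ hle
    exact Integrable.of_bound hf.aestronglyMeasurable C (Eventually.of_forall hC)
  · have h1 : ∀ r : ℝ, VectorMeasure.integral ((ComplexLevyMeasure.ofComplexMeasure m).trunc r) f
        (ContinuousLinearMap.mul ℝ ℂ) = VectorMeasure.integral m ({x | r ≤ ‖x‖}.indicator f)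
        (ContinuousLinearMap.mul ℝ ℂ) := fun r =>
      (VectorMeasure.integral_indicator (ComplexLevyMeasure.measurableSet_away r)).symm
    simp only [h1]
    refine VectorMeasure.tendsto_integral_filter_of_norm_le_const
      (Eventually.of_forall fun r => (hf.indicator
        (ComplexLevyMeasure.measurableSet_away r)).aestronglyMeasurable)
      ⟨C, Eventually.of_forall fun r => Eventually.of_forall fun u =>
        (norm_indicator_le_norm_self f u).trans (hC u)⟩ (Eventually.of_forall fun u => ?_)
    by_cases hu : u = 0
    · subst hu
      refine tendsto_const_nhds.congr fun r => ?_
      by_cases hr : (0 : EuclideanSpace ℝ (Fin d)) ∈ {x | r ≤ ‖x‖} <;> simp [Set.indicator, hf0]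
    · refine tendsto_const_nhds.congr' ?_
      filter_upwards [nhdsWithin_le_nhds (Iio_mem_nhds (norm_pos_iff.2 hu))] with r hr
      have hmem : u ∈ {x : EuclideanSpace ℝ (Fin d) | r ≤ ‖x‖} := le_of_lt (Set.mem_Iio.1 hr)
      exact (Set.indicator_of_mem hmem f).symm

lemma one_add_sq_norm_ne_zero (u : EuclideanSpace ℝ (Fin d)) : (1 + (‖u‖ : ℂ) ^ 2) ≠ 0 := by
  have : (0 : ℝ) < 1 + ‖u‖ ^ 2 := by positivity
  exact_mod_cast this.ne'

lemma norm_div_one_add_sq_norm_le {x c : ℝ} (hc : 0 ≤ c) (u : EuclideanSpace ℝ (Fin d))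
    (hx : |x| ≤ c * ‖u‖) : ‖(x : ℂ) / (1 + (‖u‖ : ℂ) ^ 2)‖ ≤ c := by
  have h1 : (1 + (‖u‖ : ℂ) ^ 2) = ((1 + ‖u‖ ^ 2 : ℝ) : ℂ) := by push_cast; rfl
  have h2 : (0 : ℝ) < 1 + ‖u‖ ^ 2 := by positivity
  rw [h1, norm_div, Complex.norm_real, Complex.norm_real, Real.norm_eq_abs,
    Real.norm_of_nonneg h2.le, div_le_iff₀ h2]
  nlinarith [sq_nonneg (‖u‖ - 1), norm_nonneg u]

lemma norm_levyIntegrand_le (t u : EuclideanSpace ℝ (Fin d)) :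
    ‖levyIntegrand t u‖ ≤ 2 + ‖t‖ := by
  have h1 : ‖expChar t u - 1‖ ≤ 2 := by
    calc ‖expChar t u - 1‖ ≤ ‖expChar t u‖ + ‖(1 : ℂ)‖ := norm_sub_le _ _
      _ = 2 := by rw [norm_expChar, norm_one]; norm_num
  have h2 : ‖Complex.I * ((inner ℝ t u : ℝ) : ℂ) / (1 + (‖u‖ : ℂ) ^ 2)‖ ≤ ‖t‖ := by
    rw [mul_div_assoc, norm_mul, Complex.norm_I, one_mul]
    exact norm_div_one_add_sq_norm_le (norm_nonneg t) u (abs_real_inner_le_norm t u)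
  exact (norm_sub_le _ _).trans (add_le_add h1 h2)

lemma measurable_levyIntegrand (t : EuclideanSpace ℝ (Fin d)) : Measurable (levyIntegrand t) := by
  refine Continuous.measurable ?_
  unfold levyIntegrand
  refine ((continuous_expChar_right t).sub continuous_const).sub
    (Continuous.div (by fun_prop) (by fun_prop) fun u => one_add_sq_norm_ne_zero u)

lemma levyIntegrand_zero (t : EuclideanSpace ℝ (Fin d)) : levyIntegrand t 0 = 0 := by
  simp [levyIntegrand]

/-- A drift and a summable atomic measure form a Lévy–Khintchine triplet, the drift being corrected
by the compensating terms `i⟨t, u⟩ / (1 + ‖u‖²)`. -/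
lemma exists_levyKhintchine_of_atomic (hS : S.Countable) (ha : Summable fun u : S => ‖a u‖)
    (γ : EuclideanSpace ℝ (Fin d)) :
    ∃ (γ' : Fin d → ℂ) (Q : Matrix (Fin d) (Fin d) ℂ) (ν : ComplexLevyMeasure d),
      (∫⁻ x, ENNReal.ofReal (min (‖x‖ ^ 2) 1) ∂ν.totalVariation) < ∞ ∧
      ∃ Ψ : EuclideanSpace ℝ (Fin d) → ℂ,
        (∀ t, ν.HasIntegral (levyIntegrand t) (Ψ t)) ∧
        ∀ t, Complex.I * ((inner ℝ t γ : ℝ) : ℂ) + ∑' u : S, a u * (expChar t u - 1) =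
          Complex.I * (toComplexVec t ⬝ᵥ γ')
            - 1 / 2 * (toComplexVec t ⬝ᵥ (Q *ᵥ toComplexVec t)) + Ψ t := by
  have hfin := isFiniteMeasure_variation_atomicMeasure ha
  have hsum : ∀ {g : S → ℂ} {C : ℝ}, (∀ u, ‖g u‖ ≤ C) → Summable fun u : S => a u * g u := by
    intro g C hg
    refine Summable.of_norm_bounded (ha.mul_right C) fun u => ?_
    rw [norm_mul]
    exact mul_le_mul_of_nonneg_left (hg u) (norm_nonneg _)
  have hcoord : ∀ (j : Fin d) (u : EuclideanSpace ℝ (Fin d)),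
      ‖((u j : ℝ) : ℂ) / (1 + (‖u‖ : ℂ) ^ 2)‖ ≤ 1 := fun j u =>
    norm_div_one_add_sq_norm_le zero_le_one u (by simpa using PiLp.norm_apply_le u j)
  refine ⟨fun j => (γ j : ℂ) + ∑' u : S, a u * (((u : EuclideanSpace ℝ (Fin d)) j : ℂ) /
      (1 + (‖(u : EuclideanSpace ℝ (Fin d))‖ : ℂ) ^ 2)), 0,
    .ofComplexMeasure (atomicMeasure S a), ?_, fun t => ∑' u : S, a u * levyIntegrand t u,
    fun t => ?_, fun t => ?_⟩
  · have hle := ComplexLevyMeasure.totalVariation_ofComplexMeasure_le (atomicMeasure S a)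
    have := isFiniteMeasure_of_le _ hle
    refine lt_of_le_of_lt (lintegral_mono (g := fun _ => 1) fun x => ?_) (by simp)
    exact ENNReal.ofReal_le_one.2 (min_le_right _ _)
  · beta_reduce
    rw [← integral_atomicMeasure hS ha (measurable_levyIntegrand t) (norm_levyIntegrand_le t)]
    exact ComplexLevyMeasure.hasIntegral_ofComplexMeasure _ (measurable_levyIntegrand t)
      (norm_levyIntegrand_le t) (levyIntegrand_zero t)
  · have hinner : ∀ u : EuclideanSpace ℝ (Fin d),
        ((inner ℝ t u : ℝ) : ℂ) = ∑ j, (t j : ℂ) * (u j : ℂ) := by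
      intro u
      rw [PiLp.inner_apply]
      push_cast
      exact Finset.sum_congr rfl fun j _ => by simp [mul_comm]
    have hdrift : toComplexVec t ⬝ᵥ (fun j => (γ j : ℂ) +
        ∑' u : S, a u * (((u : EuclideanSpace ℝ (Fin d)) j : ℂ) /
          (1 + (‖(u : EuclideanSpace ℝ (Fin d))‖ : ℂ) ^ 2))) =
        ((inner ℝ t γ : ℝ) : ℂ) + ∑' u : S, a u * (((inner ℝ t (u : EuclideanSpace ℝ (Fin d)) : ℝ) :
          ℂ) / (1 + (‖(u : EuclideanSpace ℝ (Fin d))‖ : ℂ) ^ 2)) := by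
      simp only [dotProduct, toComplexVec, mul_add, Finset.sum_add_distrib, hinner,
        Finset.sum_div, Finset.mul_sum]
      rw [Summable.tsum_finsetSum fun j _ => ?_]
      · congr 1
        refine Finset.sum_congr rfl fun j _ => ?_
        rw [← tsum_mul_left]
        exact tsum_congr fun u => by ring
      · refine ((hsum fun u : S => hcoord j u).mul_left (t j : ℂ)).congr fun u => by ring
    have hs1 : Summable fun u : S => a u * levyIntegrand t u :=
      hsum fun u => norm_levyIntegrand_le t u
    have hs2 : Summable fun u : S => a u * (((inner ℝ t (u : EuclideanSpace ℝ (Fin d)) : ℝ) :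
          ℂ) / (1 + (‖(u : EuclideanSpace ℝ (Fin d))‖ : ℂ) ^ 2)) :=
      hsum fun u => norm_div_one_add_sq_norm_le (norm_nonneg t) _ (abs_real_inner_le_norm t _)
    rw [hdrift, mul_add, ← tsum_mul_left, Matrix.zero_mulVec, dotProduct_zero, mul_zero, sub_zero,
      add_assoc, ← (hs2.mul_left Complex.I).tsum_add hs1]
    congr 1
    refine tsum_congr fun u => ?_
    rw [levyIntegrand]
    ring

end AtomicMeasure

/-! ### The equivalence -/

theorem theorem6 {d : ℕ} (h : EuclideanSpace ℝ (Fin d) → ℂ)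
    (Y : Set (EuclideanSpace ℝ (Fin d))) (hY : Y.Nonempty) (hYc : Y.Countable)
    (q : EuclideanSpace ℝ (Fin d) → ℂ)
    (hq : Summable fun y : Y => ‖q y‖) (hq0 : 0 < ∑' y : Y, ‖q y‖)
    (hh : ∀ t, h t = ∑' y : Y, q y * expChar t y)
    (h0 : h 0 = 1) :
    List.TFAE [
      -- (i)
      0 < ⨅ t, ‖h t‖,
      -- (ii)
      (∀ t, h t ≠ 0) ∧
        ∃ (Z : Set (EuclideanSpace ℝ (Fin d))) (r : EuclideanSpace ℝ (Fin d) → ℂ),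
          Z.Countable ∧ (Summable fun z : Z => ‖r z‖) ∧
          ∀ t, 1 / h t = ∑' z : Z, r z * expChar t z,
      -- (iii)
      ∃ γ ∈ coordSpan Y, ∃ l : EuclideanSpace ℝ (Fin d) → ℂ,
        (Summable fun u : ↥(coordSpan Y \ {0}) => ‖l u‖) ∧
        ∀ t, h t = Complex.exp (Complex.I * ((inner ℝ t γ : ℝ) : ℂ) +
          ∑' u : ↥(coordSpan Y \ {0}), l u * (expChar t u - 1)),
      -- (iv)
      ∃ (γ : Fin d → ℂ) (Q : Matrix (Fin d) (Fin d) ℂ) (ν : ComplexLevyMeasure d),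
        (∫⁻ x, ENNReal.ofReal (min (‖x‖ ^ 2) 1) ∂ν.totalVariation) < ∞ ∧
        ∃ Ψ : EuclideanSpace ℝ (Fin d) → ℂ,
          (∀ t, ν.HasIntegral (levyIntegrand t) (Ψ t)) ∧
          ∀ t, h t = Complex.exp (Complex.I * (toComplexVec t ⬝ᵥ γ)
            - 1 / 2 * (toComplexVec t ⬝ᵥ (Q *ᵥ toComplexVec t)) + Ψ t)] := by
  have hbound : ∀ {c : ℝ}, 0 < c → (∀ t, c ≤ ‖h t‖) → 0 < ⨅ t, ‖h t‖ := fun hc hle =>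
    hc.trans_le (le_ciInf hle)
  have hne : ∀ {F : EuclideanSpace ℝ (Fin d) → ℂ}, (∀ t, h t = Complex.exp (F t)) →
      ∀ t, h t ≠ 0 := fun hF t => by
    rw [hF]
    exact Complex.exp_ne_zero _
  tfae_have 1 → 3 := by
    intro hinf
    refine exists_levyExponent hq hh h0 hinf fun t => ciInf_le ⟨0, ?_⟩ t
    rintro _ ⟨s, rfl⟩
    exact norm_nonneg _
  tfae_have 3 → 2 := by
    rintro ⟨γ, hγ, l, hl, hhl⟩
    obtain ⟨r, hr, hhr⟩ := exists_reciprocal_expansion hγ hl hhl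
    exact ⟨hne hhl, coordSpan Y, r, countable_coordSpan hYc, hr, hhr⟩
  tfae_have 2 → 1 := by
    rintro ⟨hh0, Z, r, -, hr, hhr⟩
    have hle : ∀ t, ‖h t‖⁻¹ ≤ ∑' z : Z, ‖r z‖ := fun t => by
      have := (hasAbsExpansion_tsum_coordSpan hr hhr).norm_le t
      rwa [norm_div, norm_one, one_div] at this
    have hpos : 0 < ∑' z : Z, ‖r z‖ := by
      have := hle 0
      rw [h0, norm_one, inv_one] at this
      linarith
    exact hbound (inv_pos.2 hpos) fun t => inv_le_of_inv_le₀ (norm_pos_iff.2 (hh0 t)) (hle t)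
  tfae_have 3 → 4 := by
    rintro ⟨γ, -, l, hl, hhl⟩
    obtain ⟨γ', Q, ν, hν, Ψ, hΨ, hexp⟩ :=
      exists_levyKhintchine_of_atomic ((countable_coordSpan hYc).mono Set.sdiff_subset) hl γ
    exact ⟨γ', Q, ν, hν, Ψ, hΨ, fun t => by rw [hhl, hexp]⟩
  tfae_have 4 → 1 := by
    rintro ⟨γ, Q, ν, hν, Ψ, hΨ, hhΨ⟩
    obtain ⟨c, hc, hle⟩ := exists_lower_bound_of_levyKhintchine hq hh hq0 hν hΨ hhΨ
    exact hbound hc hle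
  tfae_finish
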